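/- \textbf{Setting.} Let $\ell>0$, $L,\sigma\ge 0$ with $L^2+\sigma^2>0$, and $\epsilon>0$. Let $\mathcal Y\subset\mathbb R^n$ be a nonempty closed bounded convex set of diameter $D\ge 0$. Let $f:\mathbb R^m\times\mathbb R^n\to\mathbb R$ be $\ell$-smooth (differentiable with $\|\nabla f(z)-\nabla f(z')\|\le \ell\|z-z'\|$ for all $z,z'$), with $f(\cdot,y)$ $L$-Lipschitz for every $y\in\mathcal Y$ and $f(x,\cdot)$ concave for every $x\in\mathbb R^m$. Put $\Phi(x)=\max_{y\in\mathcal Y}f(x,y)$, assume that $\Phi$ is bounded below, and let $\Phi_{1/2\ell}(x)=\min_{w}\{\Phi(w)+\ell\|w-x\|^2\}$ be its Moreau envelope. Let $G=(G_x,G_y)$ be a stochastic gradient oracle, i.e. for every $(x,y)$, $\mathbb E[G(x,y,\xi)]=\nabla f(x,y)$ and $\mathbb E\|G(x,y,\xi)-\nabla f(x,y)\|^2\le\sigma^2$. Fix $x_0\in\mathbb R^m$ and $y_0\in\mathcal Y$, and put $\widehat\Delta_\Phi=\Phi_{1/2\ell}(x_0)-\inf_x\Phi_{1/2\ell}(x)$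 and $\widehat\Delta_0=\Phi(x_0)-f(x_0,y_0)$. \textbf{Algorithm (two-time-scale SGDA, batch size $M=1$).} With i.i.d. samples $\xi_1,\xi_2,\dots$ and the Euclidean projection $\mathcal P_{\mathcal Y}$ onto $\mathcal Y$, for $t=1,\dots,T$ set $$x_t=x_{t-1}-\eta_x G_x(x_{t-1},y_{t-1},\xi_t),\qquad y_t=\mathcal P_{\mathcal Y}\bigl(y_{t-1}+\eta_y G_y(x_{t-1},y_{t-1},\xi_t)\bigr),$$ and return $\hat x=x_\tau$, with $\tau$ uniform on $\{1,\dots,T\}$ and independent of the samples. The stepsizes are $$\eta_y=\min\Bigl\{\frac1{2\ell},\frac{\epsilon^2}{16\ell\sigma^2}\Bigr\},\qquad \eta_x=\min\Bigl\{\frac{\epsilon^2}{16\ell(L^2+\sigma^2)},\ \frac{\epsilon^4}{8192\,\ell^3D^2L\sqrt{L^2+\sigma^2}},\ \frac{\epsilon^6}{65536\,\ell^3D^2\sigma^2L\sqrt{L^2+\sigma^2}}\Bigr\},$$ where a term with denominator $0$ is read as $+\infty$. \textbf{Theorem.} The envelope $\Phi_{1/2\ell}$ is differentiable, and there is a universal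 constant $C>0$ such that, for every integer $T\ge 1$ with $$T\ \ge\ C\Bigl(\frac{\ell(L^2+\sigma^2)\widehat\Delta_\Phi}{\epsilon^4}+\frac{\ell\widehat\Delta_0}{\epsilon^2}\Bigr)\max\Bigl\{1,\frac{\ell^2D^2}{\epsilon^2},\frac{\ell^2D^2\sigma^2}{\epsilon^4}\Bigr\},$$ the output of $T$ iterations (using $T$ stochastic gradients) satisfies $\mathbb E\|\nabla\Phi_{1/2\ell}(\hat x)\|^2\le\epsilon^2$, and hence $\mathbb E\|\nabla\Phi_{1/2\ell}(\hat x)\|\le\epsilon$. In particular, if $\epsilon\le\ell D$, the same holds for every integer $T\ge1$ with $$T\ \ge\ C\Bigl(\frac{\ell^3(L^2+\sigma^2)D^2\widehat\Delta_\Phi}{\epsilon^6}+\frac{\ell^3D^2\widehat\Delta_0}{\epsilon^4}\Bigr)\max\Bigl\{1,\frac{\sigma^2}{\epsilon^2}\Bigr\},$$ so the iteration complexity, which is also the stochastic gradient complexity, is of the order of the right-hand side. -/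

import Mathlib

open MeasureTheory ProbabilityTheory
open scoped Gradient

namespace SGDA

/-- The Euclidean space `ℝ^k`. -/
abbrev Vec (k : ℕ) : Type := EuclideanSpace ℝ (Fin k)

/-- The Euclidean space `ℝ^m × ℝ^n = ℝ^(m+n)` of pairs `(x, y)`, with
`‖(x, y)‖² = ‖x‖² + ‖y‖²`. -/
abbrev Pair (m n : ℕ) : Type := WithLp 2 (Vec m × Vec n)

/-- The pair `(x, y)`, as a point of `ℝ^(m+n)`. -/
def mk {m n : ℕ} (x : Vec m) (y : Vec n) : Pair m n := WithLp.toLp 2 (x, y)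

/-- A function is `ℓ`-smooth if it is differentiable with an `ℓ`-Lipschitz gradient. -/
def IsSmoothFun {E : Type*} [NormedAddCommGroup E] [InnerProductSpace ℝ E] [CompleteSpace E]
    (ℓ : ℝ) (f : E → ℝ) : Prop :=
  Differentiable ℝ f ∧ ∀ z z' : E, ‖∇ f z - ∇ f z'‖ ≤ ℓ * ‖z - z'‖

/-- The nonconvex-concave setting: `f` is `ℓ`-smooth on `ℝ^(m+n)`, `f(·, y)` is `L`-Lipschitz for
every `y ∈ 𝒴`, `f(x, ·)` is concave for every `x`, and `𝒴` is a nonempty closed bounded convex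
set of diameter `D`. -/
structure NonconvexConcave {m n : ℕ} (f : Pair m n → ℝ) (𝒴 : Set (Vec n)) (ℓ L D : ℝ) : Prop where
  smooth : IsSmoothFun ℓ f
  lipschitz : ∀ y ∈ 𝒴, ∀ x x' : Vec m, |f (mk x y) - f (mk x' y)| ≤ L * ‖x - x'‖
  concave : ∀ x : Vec m, ConcaveOn ℝ Set.univ (fun y : Vec n => f (mk x y))
  nonempty : 𝒴.Nonempty
  closed : IsClosed 𝒴
  convex : Convex ℝ 𝒴
  bounded : Bornology.IsBounded 𝒴
  diam : Metric.diam 𝒴 = D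

/-- `Φ(x) = max_{y ∈ 𝒴} f(x, y)`. -/
noncomputable def maxFun {m n : ℕ} (f : Pair m n → ℝ) (𝒴 : Set (Vec n)) (x : Vec m) : ℝ :=
  sSup ((fun y : Vec n => f (mk x y)) '' 𝒴)

/-- The Moreau envelope `Φ_λ(x) = min_w Φ(w) + (1 / (2λ)) ‖w - x‖²`. -/
noncomputable def moreau {E : Type*} [NormedAddCommGroup E] (lam : ℝ) (Φ : E → ℝ) (x : E) : ℝ :=
  ⨅ w : E, Φ w + 1 / (2 * lam) * ‖w - x‖ ^ 2

/-- The Euclidean projection of `y` onto `s`: a point of `s` nearest to `y`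
(unique when `s` is nonempty, closed and convex). -/
noncomputable def proj {n : ℕ} (s : Set (Vec n)) (y : Vec n) : Vec n :=
  Classical.epsilon fun p => p ∈ s ∧ ∀ q ∈ s, ‖y - p‖ ≤ ‖y - q‖

theorem proj_spec {n : ℕ} {s : Set (Vec n)} (hne : s.Nonempty) (hc : IsClosed s) (y : Vec n) :
    proj s y ∈ s ∧ ∀ q ∈ s, ‖y - proj s y‖ ≤ ‖y - q‖ := by
  refine Classical.epsilon_spec (p := fun p => p ∈ s ∧ ∀ q ∈ s, ‖y - p‖ ≤ ‖y - q‖) ?_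
  obtain ⟨p, hp, h⟩ := hc.exists_infDist_eq_dist hne y
  refine ⟨p, hp, fun q hq => ?_⟩
  rw [← dist_eq_norm, ← dist_eq_norm, ← h]
  exact Metric.infDist_le_dist_of_mem hq

/-- A stochastic gradient oracle `G(x, y, ξ)`, where `ξ` has law `P`: it is measurable, unbiased,
and of variance at most `σ²`. -/
structure IsOracle {m n : ℕ} {Ξ : Type*} [MeasurableSpace Ξ] (P : Measure Ξ)
    (f : Pair m n → ℝ) (G : Pair m n → Ξ → Pair m n) (σ : ℝ) : Prop where
  measurable : Measurable (Function.uncurry G)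
  integrable : ∀ z, Integrable (G z) P
  unbiased : ∀ z, ∫ s, (G z s - ∇ f z) ∂P = 0
  integrable_sq : ∀ z, Integrable (fun s => ‖G z s - ∇ f z‖ ^ 2) P
  variance : ∀ z, ∫ s, ‖G z s - ∇ f z‖ ^ 2 ∂P ≤ σ ^ 2

/-- One iteration of SGDA with batch `s` of size `M`, from the point `z = (x, y)`. -/
noncomputable def step {m n : ℕ} {Ξ : Type*} (𝒴 : Set (Vec n)) (G : Pair m n → Ξ → Pair m n)
    (ηx ηy : ℝ) {M : ℕ} (s : Fin M → Ξ) (z : Pair m n) : Pair m n :=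
  mk (z.fst - ηx • ((1 / (M : ℝ)) • ∑ i, (G z (s i)).fst))
    (proj 𝒴 (z.snd + ηy • ((1 / (M : ℝ)) • ∑ i, (G z (s i)).snd)))

/-- The iterates `(x_t, y_t)` of two-time-scale SGDA with batch size `M`, started at `(x₀, y₀)`;
the samples `ξ_1, …, ξ_M` drawn in iteration `t + 1` are `ξ t 0, …, ξ t (M - 1)`. -/
noncomputable def iterate {m n : ℕ} {Ξ : Type*} (𝒴 : Set (Vec n)) (G : Pair m n → Ξ → Pair m n)
    (ηx ηy : ℝ) (x₀ : Vec m) (y₀ : Vec n) {M : ℕ} (ξ : ℕ → Fin M → Ξ) : ℕ → Pair m n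
  | 0 => mk x₀ y₀
  | t + 1 => step 𝒴 G ηx ηy (ξ t) (iterate 𝒴 G ηx ηy x₀ y₀ ξ t)

/-- The randomness of a run of `T` iterations of SGDA with batch size `M`: i.i.d. samples `ξ` of
law `P`, and an index `τ`, uniform on `{1, …, T}` and independent of the samples. -/
structure IsRun {Ω Ξ : Type*} [MeasurableSpace Ω] [MeasurableSpace Ξ] (μ : Measure Ω)
    (P : Measure Ξ) {M : ℕ} (ξ : ℕ → Fin M → Ω → Ξ) (T : ℕ) (τ : Ω → ℕ) : Prop where
  measurable : ∀ t i, Measurable (ξ t i)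
  law : ∀ t i, μ.map (ξ t i) = P
  indep : iIndepFun (fun p : ℕ × Fin M => ξ p.1 p.2) μ
  measurable_index : Measurable τ
  uniform_index : ∀ t ∈ Finset.Icc 1 T, μ.real (τ ⁻¹' {t}) = 1 / (T : ℝ)
  indep_index : IndepFun τ (fun ω (p : ℕ × Fin M) => ξ p.1 p.2 ω) μ

/-- The point `x̂ = x_τ` returned by SGDA. -/
noncomputable def output {m n : ℕ} {Ω Ξ : Type*} (𝒴 : Set (Vec n)) (G : Pair m n → Ξ → Pair m n)
    (ηx ηy : ℝ) (x₀ : Vec m) (y₀ : Vec n) {M : ℕ} (ξ : ℕ → Fin M → Ω → Ξ) (τ : Ω → ℕ)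
    (ω : Ω) : Vec m :=
  (iterate 𝒴 G ηx ηy x₀ y₀ (fun t i => ξ t i ω) (τ ω)).fst

/-- The stepsize `η_y = min {1 / (2ℓ), ε² / (16 ℓ σ²)}`, written as the inverse of a maximum so
that a vanishing denominator means that the corresponding term is `+∞`. -/
noncomputable def etaY (ℓ σ ε : ℝ) : ℝ := 1 / max (2 * ℓ) (16 * ℓ * σ ^ 2 / ε ^ 2)

/-- The stepsize `η_x = min {ε² / (16 ℓ (L² + σ²)), ε⁴ / (8192 ℓ³ D² L √(L² + σ²)),
ε⁶ / (65536 ℓ³ D² σ² L √(L² + σ²))}`, with the same convention. -/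
noncomputable def etaX (ℓ L σ D ε : ℝ) : ℝ :=
  1 / max (16 * ℓ * (L ^ 2 + σ ^ 2) / ε ^ 2)
    (max (8192 * ℓ ^ 3 * D ^ 2 * L * √(L ^ 2 + σ ^ 2) / ε ^ 4)
      (65536 * ℓ ^ 3 * D ^ 2 * σ ^ 2 * L * √(L ^ 2 + σ ^ 2) / ε ^ 6))

theorem one_div_max {a b : ℝ} (ha : 0 < a) (hb : 0 < b) : 1 / max a b = min (1 / a) (1 / b) := by
  rcases le_total a b with h | h
  · rw [max_eq_right h, min_eq_right (one_div_le_one_div_of_le ha h)]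
  · rw [max_eq_left h, min_eq_left (one_div_le_one_div_of_le hb h)]

theorem etaY_eq_min {ℓ σ ε : ℝ} (hℓ : 0 < ℓ) (hσ : 0 < σ) (hε : 0 < ε) :
    etaY ℓ σ ε = min (1 / (2 * ℓ)) (ε ^ 2 / (16 * ℓ * σ ^ 2)) := by
  rw [etaY, one_div_max (by positivity) (by positivity), one_div_div]

theorem etaX_eq_min {ℓ L σ D ε : ℝ} (hℓ : 0 < ℓ) (hL : 0 < L) (hσ : 0 < σ) (hD : 0 < D)
    (hε : 0 < ε) :
    etaX ℓ L σ D ε = min (ε ^ 2 / (16 * ℓ * (L ^ 2 + σ ^ 2)))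
      (min (ε ^ 4 / (8192 * ℓ ^ 3 * D ^ 2 * L * √(L ^ 2 + σ ^ 2)))
        (ε ^ 6 / (65536 * ℓ ^ 3 * D ^ 2 * σ ^ 2 * L * √(L ^ 2 + σ ^ 2)))) := by
  rw [etaX, one_div_max (by positivity) (lt_max_of_lt_left (by positivity)),
    one_div_max (by positivity) (by positivity), one_div_div, one_div_div, one_div_div]

/-- `Δ̂_Φ = Φ_{1/2ℓ}(x₀) - min_x Φ_{1/2ℓ}(x)`. -/
noncomputable def deltaPhi {m n : ℕ} (f : Pair m n → ℝ) (𝒴 : Set (Vec n)) (ℓ : ℝ)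
    (x₀ : Vec m) : ℝ :=
  moreau (1 / (2 * ℓ)) (maxFun f 𝒴) x₀ - ⨅ x, moreau (1 / (2 * ℓ)) (maxFun f 𝒴) x

/-- `Δ̂_0 = Φ(x₀) - f(x₀, y₀)`. -/
noncomputable def deltaZero {m n : ℕ} (f : Pair m n → ℝ) (𝒴 : Set (Vec n)) (x₀ : Vec m)
    (y₀ : Vec n) : ℝ :=
  maxFun f 𝒴 x₀ - f (mk x₀ y₀)

/-- The random point `X` is an `ε`-stationary point of `Φ` in expectation: `Φ_{1/2ℓ}` is
differentiable, `𝔼 ‖∇Φ_{1/2ℓ}(X)‖² ≤ ε²` and `𝔼 ‖∇Φ_{1/2ℓ}(X)‖ ≤ ε`. -/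
def IsStationary {m : ℕ} {Ω : Type*} [MeasurableSpace Ω] (μ : Measure Ω) (ℓ ε : ℝ)
    (Φ : Vec m → ℝ) (X : Ω → Vec m) : Prop :=
  Differentiable ℝ (moreau (1 / (2 * ℓ)) Φ) ∧
  Integrable (fun ω => ‖∇ (moreau (1 / (2 * ℓ)) Φ) (X ω)‖ ^ 2) μ ∧
  ∫ ω, ‖∇ (moreau (1 / (2 * ℓ)) Φ) (X ω)‖ ^ 2 ∂μ ≤ ε ^ 2 ∧
  Integrable (fun ω => ‖∇ (moreau (1 / (2 * ℓ)) Φ) (X ω)‖) μ ∧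
  ∫ ω, ‖∇ (moreau (1 / (2 * ℓ)) Φ) (X ω)‖ ∂μ ≤ ε

end SGDA

/-!
# Complexity of stochastic gradient descent ascent in the nonconvex-concave setting

Write `λ = 1 / (2ℓ)` and `S² = L² + σ²`. Let `p` be the proximal point of `x`, and let
`Δ_t = Φ(x_t) - f(x_t, y_t)` be the gap of the iterate. The function `Φ` is `L`-Lipschitz and
`ℓ`-weakly convex, so `Φ(w) + ℓ ‖w - x‖²` is `ℓ`-strongly convex in `w`, the proximal map is
`2`-Lipschitz, and `Φ_λ` is differentiable with gradient `2ℓ (x - p)` (`hasGradientAt_moreau`).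

*Descent in `x`.* Testing the envelope at `x_{t+1}` with the proximal point of `x_t` gives
`𝔼 Φ_λ(x_{t+1}) ≤ 𝔼 Φ_λ(x_t) + 2ℓ η_x 𝔼 Δ_t - (η_x / 2) 𝔼 ‖∇Φ_λ(x_t)‖² + ℓ η_x² S²`
(`IsTrajectory.integral_moreau_succ_le`). It is summed over `T + 1` steps, since the output is one
of `x_1, …, x_T` and the last of these is controlled only by the step that follows it.

*The gaps.* A projected ascent step makes progress against any fixed comparator `c`, and `Δ_t` is
compared with the gap relative to a `c` that is nearly optimal at the beginning of a block of `B`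
steps. The error made by freezing `c` is a drift: the differences `f(x, y₁) - f(x, y₂)` are
`A`-Lipschitz in `x`, with `A = 2L` or `A = ℓ D`. Over `T` steps cut into `k` blocks this gives
`∑ 𝔼 Δ_t ≤ T (A η_x S B + η_y σ²) + k D² / (2 η_y)` up to a selection error
(`IsTrajectory.sum_gap_le`).

*Choice of the block length.* Let `K = ℓ D² / (η_y ε²)`; the stepsizes give
`η_x · 4096 ℓ L S K ≤ ε²`. If `K ≤ 1 / 16`, blocks of length one with `A = ℓ D` suffice. If
`K > 1 / 16`, one takes `B ≈ 16 K` and `A = 2L`. If `T < B` there is a single block; then either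
the initial gap is so small that `y₀` itself is an admissible comparator with no distance term, or
the lower bound on `T` amortizes `D² / (2 η_y)` (`IsTrajectory.sum_gap_le_of_stepsize`). When
`K ≤ 1 / 16`, the product `ℓ D` is small relative to `ε`, and this is useful only if `ε < 4L / 3`;
for larger `ε` the crude bound `‖∇Φ_λ‖ ≤ 4L / 3` already proves the claim.

The expectations factor because the sample drawn in an iteration is independent of the history, and
the random index is independent of all samples (`isTrajectory_point`, `IsRun.integral_index`).
-/

namespace SGDA

/-! ### Smooth functions -/

section Smooth

variable {E : Type*} [NormedAddCommGroup E] [InnerProductSpace ℝ E]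

theorem IsSmoothFun.continuous [CompleteSpace E] {ℓ : ℝ} {f : E → ℝ} (hf : IsSmoothFun ℓ f) :
    Continuous f :=
  hf.1.continuous

theorem IsSmoothFun.hasDerivAt_line [CompleteSpace E] {ℓ : ℝ} {f : E → ℝ}
    (hf : IsSmoothFun ℓ f) (z v : E) (t : ℝ) :
    HasDerivAt (fun t : ℝ => f (z + t • v)) (inner ℝ (∇ f (z + t • v)) v) t := by
  have h1 : HasDerivAt (fun t : ℝ => z + t • v) v t := by
    have := ((hasDerivAt_id t).smul_const v).const_add z
    rwa [one_smul] at this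
  have h2 := (hf.1 (z + t • v)).hasFDerivAt.comp_hasDerivAt t h1
  rwa [← inner_gradient_left] at h2

/-- The two-sided quadratic bound for a function with `ℓ`-Lipschitz gradient. -/
theorem IsSmoothFun.abs_sub_sub_inner_le [CompleteSpace E] {ℓ : ℝ} {f : E → ℝ}
    (hf : IsSmoothFun ℓ f) (z w : E) :
    |f w - f z - inner ℝ (∇ f z) (w - z)| ≤ ℓ / 2 * ‖w - z‖ ^ 2 := by
  set v := w - z with hv
  have hg : ∀ t : ℝ, HasDerivAt (fun t : ℝ => f (z + t • v) - f z - t * inner ℝ (∇ f z) v)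
      (inner ℝ (∇ f (z + t • v)) v - inner ℝ (∇ f z) v) t := by
    intro t
    have h3 := ((hf.hasDerivAt_line z v t).sub_const (f z)).sub
      ((hasDerivAt_id t).mul_const (inner ℝ (∇ f z) v))
    rw [one_mul] at h3
    exact h3
  have hB : ∀ t : ℝ, HasDerivAt (fun t : ℝ => ℓ / 2 * ‖v‖ ^ 2 * t ^ 2) (ℓ * ‖v‖ ^ 2 * t) t := by
    intro t
    exact ((hasDerivAt_pow 2 t).const_mul (ℓ / 2 * ‖v‖ ^ 2)).congr_deriv (by push_cast; ring)
  have key := image_norm_le_of_norm_deriv_right_le_deriv_boundary (a := 0) (b := 1)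
    (fun t _ => (hg t).continuousAt.continuousWithinAt)
    (fun t _ => (hg t).hasDerivWithinAt) (B := fun t : ℝ => ℓ / 2 * ‖v‖ ^ 2 * t ^ 2)
    (B' := fun t => ℓ * ‖v‖ ^ 2 * t) (by simp) hB
    (fun t ht => by
      rw [← inner_sub_left, Real.norm_eq_abs]
      calc |inner ℝ (∇ f (z + t • v) - ∇ f z) v| ≤ ‖∇ f (z + t • v) - ∇ f z‖ * ‖v‖ :=
            abs_real_inner_le_norm _ _
        _ ≤ ℓ * ‖z + t • v - z‖ * ‖v‖ := by gcongr; exact hf.2 _ _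
        _ = ℓ * ‖v‖ ^ 2 * t := by
            rw [add_sub_cancel_left, norm_smul, Real.norm_of_nonneg ht.1]; ring)
    (Set.right_mem_Icc.2 zero_le_one)
  simpa [hv, Real.norm_eq_abs] using key

/-- A bound `a ≤ b + c t` for all small `t > 0` persists at `t = 0`. -/
theorem le_of_forall_le_add_mul {a b c : ℝ} (h : ∀ t : ℝ, 0 < t → t < 1 → a ≤ b + c * t) :
    a ≤ b := by
  have h1 : Filter.Tendsto (fun t : ℝ => b + c * t) (nhdsWithin 0 (Set.Ioi 0)) (nhds b) := by
    have : Continuous (fun t : ℝ => b + c * t) := by fun_prop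
    simpa using (this.tendsto 0).mono_left nhdsWithin_le_nhds
  refine ge_of_tendsto h1 ?_
  filter_upwards [Ioo_mem_nhdsGT (zero_lt_one' ℝ)] with t ht using h t ht.1 ht.2

end Smooth

/-! ### Partial gradients -/

section Partial

variable {m n : ℕ} {f : Pair m n → ℝ} {𝒴 : Set (Vec n)} {ℓ L D : ℝ}

theorem mk_sub_mk (x x' : Vec m) (y y' : Vec n) : mk x y - mk x' y' = mk (x - x') (y - y') := rfl

theorem norm_sq_mk (x : Vec m) (y : Vec n) : ‖mk x y‖ ^ 2 = ‖x‖ ^ 2 + ‖y‖ ^ 2 :=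
  WithLp.prod_norm_sq_eq_of_L2 _

theorem norm_mk_zero_right (x : Vec m) : ‖mk x (0 : Vec n)‖ = ‖x‖ := by
  rw [← sq_eq_sq₀ (norm_nonneg _) (norm_nonneg _), norm_sq_mk]; simp

theorem norm_mk_zero_left (y : Vec n) : ‖mk (0 : Vec m) y‖ = ‖y‖ := by
  rw [← sq_eq_sq₀ (norm_nonneg _) (norm_nonneg _), norm_sq_mk]; simp

theorem inner_mk (g : Pair m n) (x : Vec m) (y : Vec n) :
    inner ℝ g (mk x y) = inner ℝ g.fst x + inner ℝ g.snd y :=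
  WithLp.prod_inner_apply _ _

theorem norm_fst_le (z : Pair m n) : ‖z.fst‖ ≤ ‖z‖ := by
  rw [← sq_le_sq₀ (norm_nonneg _) (norm_nonneg _), WithLp.prod_norm_sq_eq_of_L2]
  linarith [sq_nonneg ‖z.snd‖]

theorem mk_eta (z : Pair m n) : mk z.fst z.snd = z := rfl

theorem norm_snd_le (z : Pair m n) : ‖z.snd‖ ≤ ‖z‖ := by
  rw [← sq_le_sq₀ (norm_nonneg _) (norm_nonneg _), WithLp.prod_norm_sq_eq_of_L2]
  linarith [sq_nonneg ‖z.fst‖]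

theorem mk_inner (x : Vec m) (y : Vec n) (g : Pair m n) :
    inner ℝ (mk x y) g = inner ℝ x g.fst + inner ℝ y g.snd :=
  WithLp.prod_inner_apply _ _

theorem IsSmoothFun.abs_fst_le (hf : IsSmoothFun ℓ f) (x x' : Vec m) (y : Vec n) :
    |f (mk x' y) - f (mk x y) - inner ℝ (∇ f (mk x y)).fst (x' - x)| ≤ ℓ / 2 * ‖x' - x‖ ^ 2 := by
  have h := hf.abs_sub_sub_inner_le (mk x y) (mk x' y)
  rw [mk_sub_mk, sub_self, inner_mk, inner_zero_right, add_zero, norm_mk_zero_right] at h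
  exact h

theorem IsSmoothFun.abs_snd_le (hf : IsSmoothFun ℓ f) (x : Vec m) (y y' : Vec n) :
    |f (mk x y') - f (mk x y) - inner ℝ (∇ f (mk x y)).snd (y' - y)| ≤ ℓ / 2 * ‖y' - y‖ ^ 2 := by
  have h := hf.abs_sub_sub_inner_le (mk x y) (mk x y')
  rw [mk_sub_mk, sub_self, inner_mk, inner_zero_right, zero_add, norm_mk_zero_left] at h
  exact h

theorem IsSmoothFun.continuous_gradient (hf : IsSmoothFun ℓ f) : Continuous (∇ f) :=
  (LipschitzWith.of_dist_le' (K := ℓ) fun z z' => by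
    rw [dist_eq_norm, dist_eq_norm]; exact hf.2 z z').continuous

theorem continuous_mk : Continuous fun p : Vec m × Vec n => mk p.1 p.2 :=
  WithLp.prod_continuous_toLp 2 _ _

/-- The mixed difference of `f` in `x` and `y` is at most `ℓ ‖x' - x‖ ‖y₁ - y₂‖`. -/
theorem IsSmoothFun.mixed_difference_le (hf : IsSmoothFun ℓ f) (x x' : Vec m) (y₁ y₂ : Vec n) :
    f (mk x' y₁) - f (mk x' y₂) ≤ f (mk x y₁) - f (mk x y₂) + ℓ * ‖y₁ - y₂‖ * ‖x' - x‖ := by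
  set v : Pair m n := mk (x' - x) 0 with hv
  have e : ∀ y : Vec n, mk x y + (1 : ℝ) • v = mk x' y := fun y => by
    rw [one_smul, eq_comm, ← sub_eq_iff_eq_add', mk_sub_mk, sub_self]
  have key := norm_image_sub_le_of_norm_deriv_le_segment_01'
    (f := fun t : ℝ => f (mk x y₁ + t • v) - f (mk x y₂ + t • v))
    (C := ℓ * ‖y₁ - y₂‖ * ‖x' - x‖)
    (fun t _ => ((hf.hasDerivAt_line (mk x y₁) v t).sub
      (hf.hasDerivAt_line (mk x y₂) v t)).hasDerivWithinAt)
    (fun t _ => by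
      rw [← inner_sub_left, Real.norm_eq_abs]
      refine (abs_real_inner_le_norm _ _).trans ?_
      rw [hv, norm_mk_zero_right]
      gcongr
      refine (hf.2 _ _).trans_eq ?_
      rw [add_sub_add_right_eq_sub, mk_sub_mk, sub_self, norm_mk_zero_left])
  simp only [e, zero_smul, add_zero, Real.norm_eq_abs] at key
  linarith [(abs_le.1 key).2]

/-- The gradient inequality for the concave function `f(x, ·)`. -/
theorem le_add_inner_snd (h : NonconvexConcave f 𝒴 ℓ L D) (x : Vec m) (y y' : Vec n) :
    f (mk x y') ≤ f (mk x y) + inner ℝ (∇ f (mk x y)).snd (y' - y) := by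
  refine le_of_forall_le_add_mul (c := ℓ / 2 * ‖y' - y‖ ^ 2) fun t ht ht1 => ?_
  have h1 := (h.concave x).2 (Set.mem_univ y) (Set.mem_univ y') (sub_nonneg.2 ht1.le) ht.le
    (by ring)
  have h2 := (abs_le.1 (h.smooth.abs_snd_le x y ((1 - t) • y + t • y'))).2
  have e : (1 - t) • y + t • y' - y = t • (y' - y) := by module
  rw [e, inner_smul_right, norm_smul, Real.norm_of_nonneg ht.le] at h2
  simp only [smul_eq_mul] at h1
  have h3 : t * f (mk x y') ≤ t * (f (mk x y) + inner ℝ (∇ f (mk x y)).snd (y' - y)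
      + ℓ / 2 * ‖y' - y‖ ^ 2 * t) := by nlinarith
  exact le_of_mul_le_mul_left h3 ht

theorem norm_gradient_fst_le (h : NonconvexConcave f 𝒴 ℓ L D) (hL : 0 ≤ L) (x : Vec m)
    {y : Vec n} (hy : y ∈ 𝒴) : ‖(∇ f (mk x y)).fst‖ ≤ L := by
  set g := (∇ f (mk x y)).fst with hg
  have key : ‖g‖ ^ 2 ≤ L * ‖g‖ := by
    refine le_of_forall_le_add_mul (c := ℓ / 2 * ‖g‖ ^ 2) fun t ht ht1 => ?_
    have h1 := (abs_le.1 (h.smooth.abs_fst_le x (x + t • g) y)).1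
    have h2 := (abs_le.1 (h.lipschitz y hy (x + t • g) x)).2
    rw [add_sub_cancel_left, norm_smul, Real.norm_of_nonneg ht.le] at h1 h2
    rw [inner_smul_right, ← hg, real_inner_self_eq_norm_sq] at h1
    have h3 : t * ‖g‖ ^ 2 ≤ t * (L * ‖g‖ + ℓ / 2 * ‖g‖ ^ 2 * t) := by nlinarith
    exact le_of_mul_le_mul_left h3 ht
  by_contra! hlt
  nlinarith

theorem isCompact_domain (h : NonconvexConcave f 𝒴 ℓ L D) : IsCompact 𝒴 :=
  Metric.isCompact_of_isClosed_isBounded h.closed h.bounded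

theorem norm_sub_le_diam (h : NonconvexConcave f 𝒴 ℓ L D) {y y' : Vec n} (hy : y ∈ 𝒴)
    (hy' : y' ∈ 𝒴) : ‖y - y'‖ ≤ D := by
  rw [← h.diam, ← dist_eq_norm]
  exact Metric.dist_le_diam_of_mem h.bounded hy hy'

theorem continuous_slice (h : NonconvexConcave f 𝒴 ℓ L D) (x : Vec m) :
    Continuous fun y : Vec n => f (mk x y) :=
  h.smooth.continuous.comp (continuous_mk.comp (Continuous.prodMk_right x))

theorem le_maxFun (h : NonconvexConcave f 𝒴 ℓ L D) (x : Vec m) {y : Vec n} (hy : y ∈ 𝒴) :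
    f (mk x y) ≤ maxFun f 𝒴 x :=
  le_csSup ((isCompact_domain h).image (continuous_slice h x)).bddAbove ⟨y, hy, rfl⟩

theorem maxFun_le (h : NonconvexConcave f 𝒴 ℓ L D) {x : Vec m} {a : ℝ}
    (ha : ∀ y ∈ 𝒴, f (mk x y) ≤ a) : maxFun f 𝒴 x ≤ a :=
  csSup_le (h.nonempty.image _) (by rintro _ ⟨y, hy, rfl⟩; exact ha y hy)

theorem abs_maxFun_sub_le (h : NonconvexConcave f 𝒴 ℓ L D) (x x' : Vec m) :
    |maxFun f 𝒴 x - maxFun f 𝒴 x'| ≤ L * ‖x - x'‖ := by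
  have key : ∀ x x' : Vec m, maxFun f 𝒴 x ≤ maxFun f 𝒴 x' + L * ‖x - x'‖ := fun x x' =>
    maxFun_le h fun y hy => by
      linarith [(abs_le.1 (h.lipschitz y hy x x')).2, le_maxFun h x' hy]
  have h1 := key x x'
  have h2 := key x' x
  rw [norm_sub_rev] at h2
  rw [abs_le]; constructor <;> linarith

theorem continuous_maxFun (h : NonconvexConcave f 𝒴 ℓ L D) : Continuous (maxFun f 𝒴) :=
  (LipschitzWith.of_dist_le' (K := L) fun x x' => by
    rw [Real.dist_eq, dist_eq_norm]; exact abs_maxFun_sub_le h x x').continuous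

/-- A function is `ℓ`-weakly convex if adding `(ℓ / 2) ‖·‖²` makes it convex; this is the
equivalent inequality along segments. -/
def IsWeaklyConvex {E : Type*} [NormedAddCommGroup E] [NormedSpace ℝ E] (ℓ : ℝ) (Φ : E → ℝ) :
    Prop :=
  ∀ (p w : E) (t : ℝ), 0 < t → t < 1 →
    Φ (p + t • (w - p)) ≤ (1 - t) * Φ p + t * Φ w + ℓ / 2 * (t * (1 - t)) * ‖w - p‖ ^ 2

theorem isWeaklyConvex_maxFun (h : NonconvexConcave f 𝒴 ℓ L D) :
    IsWeaklyConvex ℓ (maxFun f 𝒴) := by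
  intro p w t ht ht1
  refine maxFun_le h fun y hy => ?_
  have h1 := (abs_le.1 (h.smooth.abs_fst_le (p + t • (w - p)) p y)).1
  have h2 := (abs_le.1 (h.smooth.abs_fst_le (p + t • (w - p)) w y)).1
  have e1 : p - (p + t • (w - p)) = (-t) • (w - p) := by module
  have e2 : w - (p + t • (w - p)) = (1 - t) • (w - p) := by module
  rw [e1, inner_smul_right, norm_smul, Real.norm_eq_abs, mul_pow, sq_abs] at h1
  rw [e2, inner_smul_right, norm_smul, Real.norm_eq_abs, mul_pow, sq_abs] at h2
  have h3 := mul_le_mul_of_nonneg_left (le_maxFun h p hy) (sub_nonneg.2 ht1.le)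
  have h4 := mul_le_mul_of_nonneg_left (le_maxFun h w hy) ht.le
  have h5 := mul_le_mul_of_nonneg_left h1 (sub_nonneg.2 ht1.le)
  have h6 := mul_le_mul_of_nonneg_left h2 ht.le
  linarith

end Partial

/-! ### The Moreau envelope of a weakly convex function -/

section Moreau

variable {E : Type*} [NormedAddCommGroup E] {ℓ L : ℝ} {Φ : E → ℝ}

/-- `p` is a proximal point of `x`: a minimizer of `w ↦ Φ(w) + ℓ ‖w - x‖²`. -/
def IsProx (ℓ : ℝ) (Φ : E → ℝ) (x p : E) : Prop :=
  ∀ w, Φ p + ℓ * ‖p - x‖ ^ 2 ≤ Φ w + ℓ * ‖w - x‖ ^ 2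

theorem bddBelow_proximal_objective (hℓ : 0 < ℓ) (hb : BddBelow (Set.range Φ)) (x : E) :
    BddBelow (Set.range fun w => Φ w + 1 / (2 * (1 / (2 * ℓ))) * ‖w - x‖ ^ 2) := by
  obtain ⟨b, hb⟩ := hb
  refine ⟨b, ?_⟩
  rintro _ ⟨w, rfl⟩
  have h1 := hb ⟨w, rfl⟩
  have : 0 ≤ 1 / (2 * (1 / (2 * ℓ))) * ‖w - x‖ ^ 2 := by positivity
  show b ≤ Φ w + 1 / (2 * (1 / (2 * ℓ))) * ‖w - x‖ ^ 2
  linarith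

theorem moreau_le (hℓ : 0 < ℓ) (hb : BddBelow (Set.range Φ)) (x w : E) :
    moreau (1 / (2 * ℓ)) Φ x ≤ Φ w + ℓ * ‖w - x‖ ^ 2 := by
  refine (ciInf_le (bddBelow_proximal_objective hℓ hb x) w).trans_eq ?_
  field_simp

theorem IsProx.moreau_eq (hℓ : 0 < ℓ) (hb : BddBelow (Set.range Φ)) {x p : E}
    (hp : IsProx ℓ Φ x p) : moreau (1 / (2 * ℓ)) Φ x = Φ p + ℓ * ‖p - x‖ ^ 2 := by
  refine le_antisymm (moreau_le hℓ hb x p) (le_ciInf fun w => (hp w).trans_eq ?_)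
  field_simp

theorem bddBelow_range_moreau (hℓ : 0 < ℓ) (hb : BddBelow (Set.range Φ)) {P : E → E}
    (hP : ∀ x, IsProx ℓ Φ x (P x)) : BddBelow (Set.range (moreau (1 / (2 * ℓ)) Φ)) := by
  obtain ⟨b, hb'⟩ := id hb
  refine ⟨b, ?_⟩
  rintro _ ⟨x, rfl⟩
  rw [(hP x).moreau_eq hℓ hb]
  have h1 : b ≤ Φ (P x) := hb' ⟨P x, rfl⟩
  have h2 : 0 ≤ ℓ * ‖P x - x‖ ^ 2 := by positivity
  linarith

variable [InnerProductSpace ℝ E]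

theorem exists_isProx [FiniteDimensional ℝ E] (hℓ : 0 < ℓ) (hc : Continuous Φ)
    (hb : BddBelow (Set.range Φ)) (x : E) : ∃ p, IsProx ℓ Φ x p := by
  have : ProperSpace E := FiniteDimensional.proper ℝ E
  obtain ⟨b, hb⟩ := hb
  refine Continuous.exists_forall_le (f := fun w => Φ w + ℓ * ‖w - x‖ ^ 2) (by fun_prop) ?_
  refine Filter.tendsto_atTop_add_left_of_le _ b (fun w => hb ⟨w, rfl⟩) ?_
  refine Filter.Tendsto.const_mul_atTop hℓ ((Filter.tendsto_pow_atTop two_ne_zero).comp ?_)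
  simp_rw [← dist_eq_norm]
  exact tendsto_dist_right_cocompact_atTop x

/-- Quadratic growth of the proximal objective, which is `ℓ`-strongly convex. -/
theorem IsProx.add_le (hΦ : IsWeaklyConvex ℓ Φ) {x p : E} (hp : IsProx ℓ Φ x p) (w : E) :
    Φ p + ℓ * ‖p - x‖ ^ 2 + ℓ / 2 * ‖w - p‖ ^ 2 ≤ Φ w + ℓ * ‖w - x‖ ^ 2 := by
  refine le_of_forall_le_add_mul (c := ℓ / 2 * ‖w - p‖ ^ 2) fun t ht ht1 => ?_
  have h1 := hp (p + t • (w - p))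
  have h2 := hΦ p w t ht ht1
  have e1 : p + t • (w - p) - x = (p - x) + t • (w - p) := by module
  have e2 : w - x = (p - x) + (w - p) := by abel
  rw [e1, norm_add_sq_real, inner_smul_right, norm_smul, Real.norm_eq_abs, mul_pow, sq_abs] at h1
  rw [e2, norm_add_sq_real]
  refine le_of_mul_le_mul_left ?_ ht
  linarith

/-- The proximal map is `2`-Lipschitz. -/
theorem IsProx.norm_sub_le (hℓ : 0 < ℓ) (hΦ : IsWeaklyConvex ℓ Φ) {x x' p p' : E}
    (hp : IsProx ℓ Φ x p) (hp' : IsProx ℓ Φ x' p') : ‖p' - p‖ ≤ 2 * ‖x' - x‖ := by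
  have h1 := hp.add_le hΦ p'
  have h2 := hp'.add_le hΦ p
  have e : ‖p' - x‖ ^ 2 - ‖p - x‖ ^ 2 + ‖p - x'‖ ^ 2 - ‖p' - x'‖ ^ 2
      = 2 * inner ℝ (p' - p) (x' - x) := by
    simp only [norm_sub_sq_real, inner_sub_left, inner_sub_right]
    ring
  rw [norm_sub_rev p p'] at h2
  have h3 := real_inner_le_norm (p' - p) (x' - x)
  have h4 : ℓ * ‖p' - p‖ ^ 2 ≤ ℓ * (2 * (‖p' - p‖ * ‖x' - x‖)) := by nlinarith
  have h5 := le_of_mul_le_mul_left h4 hℓ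
  by_contra! hlt
  nlinarith [norm_nonneg (x' - x), norm_nonneg (p' - p)]

/-- The envelope is differentiable with gradient `2ℓ (x - p)`: its difference quotients are bounded
above by testing the infimum at `x'` with `p`, and below by testing the infimum at `x` with the
proximal point of `x'`. -/
theorem hasGradientAt_moreau [CompleteSpace E] (hℓ : 0 < ℓ) (hΦ : IsWeaklyConvex ℓ Φ)
    (hb : BddBelow (Set.range Φ)) {P : E → E} (hP : ∀ x, IsProx ℓ Φ x (P x)) (x : E) :
    HasGradientAt (moreau (1 / (2 * ℓ)) Φ) ((2 * ℓ) • (x - P x)) x := by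
  rw [hasGradientAt_iff_isLittleO]
  have key : ∀ x', ‖moreau (1 / (2 * ℓ)) Φ x' - moreau (1 / (2 * ℓ)) Φ x
      - inner ℝ ((2 * ℓ) • (x - P x)) (x' - x)‖ ≤ 3 * ℓ * ‖‖x' - x‖ ^ 2‖ := by
    intro x'
    rw [Real.norm_eq_abs, Real.norm_of_nonneg (by positivity), abs_le, inner_smul_left]
    have h1 := moreau_le hℓ hb x' (P x)
    have h2 := moreau_le hℓ hb x (P x')
    have h1' := (hP x).moreau_eq hℓ hb
    have h2' := (hP x').moreau_eq hℓ hb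
    have h3 := (hP x).norm_sub_le hℓ hΦ (hP x')
    have e1 : P x - x' = (P x - x) - (x' - x) := by abel
    have e2 : P x' - x = (P x' - x') + (x' - x) := by abel
    rw [e1, norm_sub_sq_real] at h1
    rw [e2, norm_add_sq_real] at h2
    have e3 : inner ℝ (P x' - x') (x' - x) = inner ℝ (P x' - P x) (x' - x)
        + inner ℝ (P x - x) (x' - x) - ‖x' - x‖ ^ 2 := by
      rw [← real_inner_self_eq_norm_sq, ← inner_add_left, ← inner_sub_left]
      congr 1; abel
    have e4 : inner ℝ (x - P x) (x' - x) = - inner ℝ (P x - x) (x' - x) := by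
      rw [← inner_neg_left, neg_sub]
    have h4 := real_inner_le_norm (P x' - P x) (x' - x)
    have h5 : ‖P x' - P x‖ * ‖x' - x‖ ≤ 2 * ‖x' - x‖ * ‖x' - x‖ := by gcongr
    have h6 := mul_le_mul_of_nonneg_left (h4.trans h5) hℓ.le
    have h7 : 0 ≤ ℓ * ‖x' - x‖ ^ 2 := by positivity
    simp only [conj_trivial]
    rw [e4]
    rw [e3] at h2
    constructor <;> nlinarith
  refine (Asymptotics.IsBigO.of_bound _ (Filter.Eventually.of_forall key)).trans_isLittleO ?_
  have h0 : Filter.Tendsto (fun x' => x' - x) (nhds x) (nhds 0) := by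
    have : Continuous fun x' => x' - x := by fun_prop
    simpa using this.tendsto x
  exact (Asymptotics.isLittleO_norm_pow_id one_lt_two).comp_tendsto h0

/-- The envelope gradient `2ℓ (x - p)` of an `L`-Lipschitz function has norm at most `4L / 3`. The
sharp bound is `L`; this one follows at once from the quadratic growth. -/
theorem IsProx.norm_sub_le_of_lipschitz (hℓ : 0 < ℓ) (hL : 0 ≤ L) (hΦ : IsWeaklyConvex ℓ Φ)
    (hlip : ∀ x x', |Φ x - Φ x'| ≤ L * ‖x - x'‖) {x p : E} (hp : IsProx ℓ Φ x p) :
    2 * ℓ * ‖x - p‖ ≤ 4 / 3 * L := by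
  have h1 := hp.add_le hΦ x
  have h2 := (abs_le.1 (hlip x p)).2
  rw [norm_sub_rev p x, sub_self, norm_zero] at h1
  by_contra! hlt
  nlinarith [norm_nonneg (x - p)]

end Moreau

/-! ### Projection onto the constraint set and one-step inequalities -/

section OneStep

variable {m n : ℕ} {f : Pair m n → ℝ} {𝒴 : Set (Vec n)} {ℓ L D : ℝ}

theorem inner_proj_le_zero {s : Set (Vec n)} (hne : s.Nonempty) (hc : IsClosed s)
    (hconv : Convex ℝ s) (y : Vec n) {q : Vec n} (hq : q ∈ s) :
    inner ℝ (y - proj s y) (q - proj s y) ≤ 0 := by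
  obtain ⟨hmem, hmin⟩ := proj_spec hne hc y
  refine (norm_eq_iInf_iff_real_inner_le_zero hconv hmem).1 ?_ q hq
  have : Nonempty s := hne.to_subtype
  refine le_antisymm (le_ciInf fun w => hmin w w.2) ?_
  exact ciInf_le (f := fun w : s => ‖y - w‖) ⟨0, by rintro _ ⟨w, rfl⟩; exact norm_nonneg _⟩
    ⟨proj s y, hmem⟩

theorem continuous_proj {s : Set (Vec n)} (hne : s.Nonempty) (hc : IsClosed s)
    (hconv : Convex ℝ s) : Continuous (proj s) := by
  refine (LipschitzWith.of_dist_le' (K := 1) fun y y' => ?_).continuous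
  rw [dist_eq_norm, dist_eq_norm, one_mul]
  have h1 := inner_proj_le_zero hne hc hconv y (proj_spec hne hc y').1
  have h2 := inner_proj_le_zero hne hc hconv y' (proj_spec hne hc y).1
  have e : inner ℝ (y - proj s y) (proj s y' - proj s y)
      + inner ℝ (y' - proj s y') (proj s y - proj s y')
      = ‖proj s y - proj s y'‖ ^ 2 - inner ℝ (y - y') (proj s y - proj s y') := by
    rw [← real_inner_self_eq_norm_sq]
    simp only [inner_sub_left, inner_sub_right]
    ring
  have h3 := real_inner_le_norm (y - y') (proj s y - proj s y')
  by_contra! hlt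
  nlinarith [norm_nonneg (y - y'), norm_nonneg (proj s y - proj s y')]

theorem step_one {Ξ : Type*} (G : Pair m n → Ξ → Pair m n) (ηx ηy : ℝ) (s : Fin 1 → Ξ)
    (z : Pair m n) : step 𝒴 G ηx ηy s z =
      mk (z.fst - ηx • (G z (s 0)).fst) (proj 𝒴 (z.snd + ηy • (G z (s 0)).snd)) := by
  simp [step]

/-- Progress of one projected ascent step in `y` against a fixed comparator `c`. -/
theorem ascent_step (h : NonconvexConcave f 𝒴 ℓ L D) {η : ℝ} (hη : 0 ≤ η) (hηℓ : η * ℓ ≤ 1 / 2)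
    (x : Vec m) (y d : Vec n) {c : Vec n} (hc : c ∈ 𝒴) {y' : Vec n}
    (hy' : y' = proj 𝒴 (y + η • ((∇ f (mk x y)).snd + d))) :
    2 * η * (f (mk x c) - f (mk x y')) ≤
      ‖y - c‖ ^ 2 - ‖y' - c‖ ^ 2 + 2 * η * inner ℝ d (y - c) + 2 * η ^ 2 * ‖d‖ ^ 2 := by
  set g := (∇ f (mk x y)).snd with hg
  have h1 := inner_proj_le_zero h.nonempty h.closed h.convex (y + η • (g + d)) hc
  rw [← hy'] at h1
  have h2 := le_add_inner_snd h x y c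
  have h3 := (abs_le.1 (h.smooth.abs_snd_le x y y')).1
  rw [← hg] at h2 h3
  have h4 : 0 ≤ ‖(2 * η) • d + (y - y')‖ ^ 2 := by positivity
  have e0 : ‖(2 * η) • d + (y - y')‖ ^ 2 = 4 * η ^ 2 * ‖d‖ ^ 2
      + 4 * η * (inner ℝ d (y - c) - inner ℝ d (y' - c)) + ‖y' - y‖ ^ 2 := by
    rw [norm_add_sq_real, norm_smul, inner_smul_left, norm_sub_rev y y', Real.norm_eq_abs, mul_pow,
      sq_abs, ← inner_sub_right, sub_sub_sub_cancel_right]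
    simp only [conj_trivial]
    ring
  have e1 : inner ℝ (y + η • (g + d) - y') (c - y')
      = inner ℝ (y - y') (c - y') - η * inner ℝ g (y' - c) - η * inner ℝ d (y' - c) := by
    have : y + η • (g + d) - y' = (y - y') + η • g + η • d := by module
    rw [this, inner_add_left, inner_add_left, inner_smul_left, inner_smul_left,
      ← neg_sub y' c, inner_neg_right, inner_neg_right, inner_neg_right]
    simp only [conj_trivial]
    ring
  have e2 : ‖y - c‖ ^ 2 = ‖y' - y‖ ^ 2 - 2 * inner ℝ (y - y') (c - y') + ‖y' - c‖ ^ 2 := by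
    have : y - c = (y - y') - (c - y') := by abel
    rw [this, norm_sub_sq_real, norm_sub_rev y y', norm_sub_rev c y']
  have e3 : inner ℝ g (c - y) = inner ℝ g (y' - y) - inner ℝ g (y' - c) := by
    rw [← inner_sub_right]; congr 1; abel
  have h5 : 2 * η * (f (mk x c) - f (mk x y')) ≤
      2 * η * (ℓ / 2 * ‖y' - y‖ ^ 2 - inner ℝ g (y' - c)) :=
    mul_le_mul_of_nonneg_left (by linarith) (by positivity)
  have h6 : η * ℓ * ‖y' - y‖ ^ 2 ≤ 1 / 2 * ‖y' - y‖ ^ 2 := by gcongr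
  nlinarith

/-- Up to the gap `Φ(x) - f(x, y)`, the direction from `x` to its proximal point is a descent
direction for `f(·, y)`: smoothness of `f` costs `(ℓ / 2) ‖x - p‖²`, and the quadratic growth of the
proximal objective gains `(3ℓ / 2) ‖x - p‖²`. -/
theorem inner_gradient_fst_le (h : NonconvexConcave f 𝒴 ℓ L D) {x p : Vec m} {y : Vec n}
    (hy : y ∈ 𝒴) (hp : IsProx ℓ (maxFun f 𝒴) x p) :
    inner ℝ (∇ f (mk x y)).fst (p - x) ≤
      maxFun f 𝒴 x - f (mk x y) - ℓ * ‖x - p‖ ^ 2 := by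
  have h1 := (abs_le.1 (h.smooth.abs_fst_le x p y)).1
  have h2 := le_maxFun h p hy
  have h3 := hp.add_le (isWeaklyConvex_maxFun h) x
  rw [sub_self, norm_zero, norm_sub_rev p x] at h3
  rw [norm_sub_rev p x] at h1
  linarith

/-- Change of the Moreau envelope in one stochastic gradient step in `x`, with noise `d`. -/
theorem descent_step (h : NonconvexConcave f 𝒴 ℓ L D) (hℓ : 0 < ℓ) (hL : 0 ≤ L)
    (hb : BddBelow (Set.range (maxFun f 𝒴))) {η : ℝ} (hη : 0 ≤ η) {x p d : Vec m} {y : Vec n}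
    (hy : y ∈ 𝒴) (hp : IsProx ℓ (maxFun f 𝒴) x p) :
    moreau (1 / (2 * ℓ)) (maxFun f 𝒴) (x - η • ((∇ f (mk x y)).fst + d)) ≤
      moreau (1 / (2 * ℓ)) (maxFun f 𝒴) x + 2 * ℓ * η * (maxFun f 𝒴 x - f (mk x y))
        - 2 * ℓ ^ 2 * η * ‖x - p‖ ^ 2
        + inner ℝ ((2 * ℓ * η) • (p - x) + (2 * ℓ * η ^ 2) • (∇ f (mk x y)).fst) d
        + ℓ * η ^ 2 * (L ^ 2 + ‖d‖ ^ 2) := by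
  set g := (∇ f (mk x y)).fst with hg
  have h1 := moreau_le hℓ hb (x - η • (g + d)) p
  have h2 := hp.moreau_eq hℓ hb
  have h3 := inner_gradient_fst_le h hy hp
  have h4 : ‖g‖ ^ 2 ≤ L ^ 2 := by
    have := norm_gradient_fst_le h hL x hy
    gcongr
  have e1 : p - (x - η • (g + d)) = (p - x) + η • (g + d) := by abel
  rw [e1, norm_add_sq_real, inner_smul_right, norm_smul, Real.norm_eq_abs, mul_pow, sq_abs,
    inner_add_right, norm_add_sq_real, real_inner_comm g] at h1
  rw [inner_add_left, inner_smul_left, inner_smul_left]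
  simp only [conj_trivial]
  have h5 := mul_le_mul_of_nonneg_left h3 (by positivity : 0 ≤ 2 * ℓ * η)
  have h6 := mul_le_mul_of_nonneg_left h4 (by positivity : 0 ≤ ℓ * η ^ 2)
  linarith

/-- The gap `Φ(x) - f(x, y)` at a point `z = (x, y)`. -/
noncomputable def gap (f : Pair m n → ℝ) (𝒴 : Set (Vec n)) (z : Pair m n) : ℝ :=
  maxFun f 𝒴 z.fst - f z

theorem gap_nonneg (h : NonconvexConcave f 𝒴 ℓ L D) {z : Pair m n} (hz : z.snd ∈ 𝒴) :
    0 ≤ gap f 𝒴 z :=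
  sub_nonneg.2 (le_maxFun h z.fst hz)

/-- `A` bounds how fast the differences `f(x, y₁) - f(x, y₂)` over `y₁, y₂ ∈ 𝒴` vary with `x`. -/
def DriftBound (f : Pair m n → ℝ) (𝒴 : Set (Vec n)) (A : ℝ) : Prop :=
  ∀ (x x' : Vec m), ∀ y₁ ∈ 𝒴, ∀ y₂ ∈ 𝒴,
    f (mk x' y₁) - f (mk x' y₂) ≤ f (mk x y₁) - f (mk x y₂) + A * ‖x' - x‖

theorem driftBound_lipschitz (h : NonconvexConcave f 𝒴 ℓ L D) : DriftBound f 𝒴 (2 * L) :=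
  fun x x' y₁ hy₁ y₂ hy₂ => by
    have h1 := (abs_le.1 (h.lipschitz y₁ hy₁ x' x)).2
    have h2 := (abs_le.1 (h.lipschitz y₂ hy₂ x' x)).1
    linarith

theorem driftBound_diam (h : NonconvexConcave f 𝒴 ℓ L D) (hℓ : 0 ≤ ℓ) :
    DriftBound f 𝒴 (ℓ * D) :=
  fun x x' y₁ hy₁ y₂ hy₂ => by
    refine (h.smooth.mixed_difference_le x x' y₁ y₂).trans ?_
    have := norm_sub_le_diam h hy₁ hy₂
    gcongr

/-- If `c` is nearly optimal at the reference point `x₀`, the gap at `(x', y)` is controlled by the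
gap relative to `c` at any other point `x`, up to the drifts between the three points. -/
theorem gap_le_of_driftBound (h : NonconvexConcave f 𝒴 ℓ L D) {A : ℝ} (hA : DriftBound f 𝒴 A)
    {x₀ x x' : Vec m} {y c : Vec n} (hy : y ∈ 𝒴) (hc : c ∈ 𝒴) {κ : ℝ}
    (hκ : maxFun f 𝒴 x₀ - f (mk x₀ c) ≤ κ) :
    gap f 𝒴 (mk x' y) ≤
      κ + (f (mk x c) - f (mk x y)) + A * ‖x' - x₀‖ + A * ‖x - x₀‖ := by
  have h1 : maxFun f 𝒴 x' ≤ f (mk x' y) +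
      (κ + (f (mk x c) - f (mk x y)) + A * ‖x' - x₀‖ + A * ‖x - x₀‖) := by
    refine maxFun_le h fun w hw => ?_
    have h2 := hA x₀ x' w hw y hy
    have h3 := le_maxFun h x₀ hw
    have h4 := hA x x₀ c hc y hy
    rw [norm_sub_rev x₀ x] at h4
    linarith
  have e : gap f 𝒴 (mk x' y) = maxFun f 𝒴 x' - f (mk x' y) := rfl
  rw [e]
  linarith

end OneStep

/-! ### Oracle noise at a random point -/

section Noise

variable {m n : ℕ} {f : Pair m n → ℝ} {ℓ σ : ℝ}
  {Ξ Ω : Type*} [MeasurableSpace Ξ] [MeasurableSpace Ω] {P : Measure Ξ} {μ : Measure Ω}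
  {G : Pair m n → Ξ → Pair m n}

theorem IsOracle.measurable_noise (hG : IsOracle P f G σ) (hf : IsSmoothFun ℓ f) :
    Measurable fun q : Pair m n × Ξ => G q.1 q.2 - ∇ f q.1 :=
  hG.measurable.sub (hf.continuous_gradient.measurable.comp measurable_fst)

theorem integrable_of_norm_le_of_sq [IsFiniteMeasure μ] {E : Type*} [NormedAddCommGroup E]
    {d : Ω → E} {F : Ω → ℝ} {R : ℝ} (hR : 0 ≤ R) (hd : Integrable (fun ω => ‖d ω‖ ^ 2) μ)
    (hF : AEStronglyMeasurable F μ) (hle : ∀ ω, |F ω| ≤ R * ‖d ω‖) : Integrable F μ := by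
  refine ((hd.add (integrable_const (1 : ℝ))).const_mul R).mono' hF
    (Filter.Eventually.of_forall fun ω => (hle ω).trans ?_)
  refine mul_le_mul_of_nonneg_left ?_ hR
  show ‖d ω‖ ≤ ‖d ω‖ ^ 2 + 1
  nlinarith [sq_nonneg (‖d ω‖ - 1 / 2)]

variable [IsProbabilityMeasure P] [IsProbabilityMeasure μ]

/-- The variance bound of the oracle persists at a random point `Z` independent of the sample. -/
theorem IsOracle.noise_sq (hG : IsOracle P f G σ) (hf : IsSmoothFun ℓ f) {Z : Ω → Pair m n}
    {X : Ω → Ξ} (hZ : Measurable Z) (hX : Measurable X) (hlaw : μ.map X = P)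
    (hind : IndepFun Z X μ) :
    Integrable (fun ω => ‖G (Z ω) (X ω) - ∇ f (Z ω)‖ ^ 2) μ ∧
      ∫ ω, ‖G (Z ω) (X ω) - ∇ f (Z ω)‖ ^ 2 ∂μ ≤ σ ^ 2 := by
  have hmap := (indepFun_iff_map_prod_eq_prod_map_map hZ.aemeasurable hX.aemeasurable).1 hind
  rw [hlaw] at hmap
  have hZX : Measurable fun ω => (Z ω, X ω) := hZ.prodMk hX
  have : IsProbabilityMeasure (μ.map Z) := Measure.isProbabilityMeasure_map hZ.aemeasurable
  have hmeas : Measurable fun q : Pair m n × Ξ => ‖G q.1 q.2 - ∇ f q.1‖ ^ 2 :=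
    (hG.measurable_noise hf).norm.pow_const 2
  have hnn : ∀ z, 0 ≤ ∫ s, ‖G z s - ∇ f z‖ ^ 2 ∂P := fun z =>
    integral_nonneg fun s => by positivity
  have hint : Integrable (fun q : Pair m n × Ξ => ‖G q.1 q.2 - ∇ f q.1‖ ^ 2)
      ((μ.map Z).prod P) := by
    rw [integrable_prod_iff hmeas.aestronglyMeasurable]
    refine ⟨Filter.Eventually.of_forall fun z => hG.integrable_sq z, ?_⟩
    refine Integrable.of_bound
      hmeas.norm.stronglyMeasurable.integral_prod_right.aestronglyMeasurable (σ ^ 2)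
      (Filter.Eventually.of_forall fun z => ?_)
    simp only [norm_pow, norm_norm]
    rw [Real.norm_of_nonneg (hnn z)]
    exact hG.variance z
  rw [← hmap] at hint
  refine ⟨hint.comp_measurable hZX, ?_⟩
  have e : ∫ ω, ‖G (Z ω) (X ω) - ∇ f (Z ω)‖ ^ 2 ∂μ
      = ∫ q, ‖G q.1 q.2 - ∇ f q.1‖ ^ 2 ∂(μ.map fun ω => (Z ω, X ω)) :=
    (integral_map hZX.aemeasurable hmeas.aestronglyMeasurable).symm
  rw [e, hmap, integral_prod _ (by rwa [← hmap])]
  calc ∫ z, ∫ s, ‖G z s - ∇ f z‖ ^ 2 ∂P ∂(μ.map Z) ≤ ∫ _, σ ^ 2 ∂(μ.map Z) :=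
        integral_mono_of_nonneg (Filter.Eventually.of_forall hnn) (integrable_const _)
          (Filter.Eventually.of_forall fun z => hG.variance z)
    _ = σ ^ 2 := by simp

/-- The noise is orthogonal to every bounded variable that is independent of the fresh sample. -/
theorem IsOracle.noise_mean (hG : IsOracle P f G σ) (hf : IsSmoothFun ℓ f) {U Z : Ω → Pair m n}
    {X : Ω → Ξ} (hU : Measurable U) (hZ : Measurable Z) (hX : Measurable X) (hlaw : μ.map X = P)
    (hind : IndepFun (fun ω => (U ω, Z ω)) X μ) {R : ℝ} (hR : ∀ ω, ‖U ω‖ ≤ R) :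
    Integrable (fun ω => inner ℝ (U ω) (G (Z ω) (X ω) - ∇ f (Z ω))) μ ∧
      ∫ ω, inner ℝ (U ω) (G (Z ω) (X ω) - ∇ f (Z ω)) ∂μ = 0 := by
  have hUZ : Measurable fun ω => (U ω, Z ω) := hU.prodMk hZ
  have hmap := (indepFun_iff_map_prod_eq_prod_map_map hUZ.aemeasurable hX.aemeasurable).1 hind
  rw [hlaw] at hmap
  have hUZX : Measurable fun ω => ((U ω, Z ω), X ω) := hUZ.prodMk hX
  have : IsProbabilityMeasure (μ.map fun ω => (U ω, Z ω)) :=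
    Measure.isProbabilityMeasure_map hUZ.aemeasurable
  have hnoise := hG.measurable_noise hf
  have hmeas : Measurable fun q : (Pair m n × Pair m n) × Ξ =>
      inner ℝ q.1.1 (G q.1.2 q.2 - ∇ f q.1.2) :=
    (measurable_fst.comp measurable_fst).inner
      (hnoise.comp ((measurable_snd.comp measurable_fst).prodMk measurable_snd))
  have hint : Integrable (fun ω => inner ℝ (U ω) (G (Z ω) (X ω) - ∇ f (Z ω))) μ := by
    have h0 : Nonempty Ω := nonempty_of_isProbabilityMeasure μ
    have hR0 : 0 ≤ R := (norm_nonneg _).trans (hR h0.some)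
    refine integrable_of_norm_le_of_sq hR0
      (hG.noise_sq hf hZ hX hlaw (hind.comp measurable_snd measurable_id)).1
      (hmeas.comp hUZX).aestronglyMeasurable fun ω => ?_
    exact (abs_real_inner_le_norm _ _).trans (by gcongr; exact hR ω)
  refine ⟨hint, ?_⟩
  have hint' : Integrable (fun q : (Pair m n × Pair m n) × Ξ =>
      inner ℝ q.1.1 (G q.1.2 q.2 - ∇ f q.1.2)) ((μ.map fun ω => (U ω, Z ω)).prod P) := by
    rw [← hmap]
    exact (integrable_map_measure hmeas.aestronglyMeasurable hUZX.aemeasurable).2 hint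
  have e : ∫ ω, inner ℝ (U ω) (G (Z ω) (X ω) - ∇ f (Z ω)) ∂μ
      = ∫ q, inner ℝ q.1.1 (G q.1.2 q.2 - ∇ f q.1.2) ∂(μ.map fun ω => ((U ω, Z ω), X ω)) :=
    (integral_map hUZX.aemeasurable hmeas.aestronglyMeasurable).symm
  rw [e, hmap, integral_prod _ hint']
  refine integral_eq_zero_of_ae (Filter.Eventually.of_forall fun q => ?_)
  have h1 : Integrable (fun s => G q.2 s - ∇ f q.2) P :=
    (hG.integrable q.2).sub (integrable_const _)
  have h2 := integral_inner (𝕜 := ℝ) h1 q.1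
  rw [hG.unbiased q.2, inner_zero_right] at h2
  exact h2

end Noise

/-! ### The history of the iterates -/

section History

variable {m n : ℕ} {f : Pair m n → ℝ} {𝒴 : Set (Vec n)} {ℓ L D σ ηx ηy : ℝ}
  {Ξ Ω : Type*} {G : Pair m n → Ξ → Pair m n} {x₀ : Vec m} {y₀ : Vec n}
  {ξ : ℕ → Fin 1 → Ω → Ξ} {T : ℕ} {τ : Ω → ℕ}

/-- The random iterate `(x_t, y_t)`. -/
noncomputable def point (𝒴 : Set (Vec n)) (G : Pair m n → Ξ → Pair m n) (ηx ηy : ℝ) (x₀ : Vec m)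
    (y₀ : Vec n) (ξ : ℕ → Fin 1 → Ω → Ξ) (t : ℕ) (ω : Ω) : Pair m n :=
  iterate 𝒴 G ηx ηy x₀ y₀ (fun t i => ξ t i ω) t

theorem point_succ (t : ℕ) (ω : Ω) : point 𝒴 G ηx ηy x₀ y₀ ξ (t + 1) ω =
    mk ((point 𝒴 G ηx ηy x₀ y₀ ξ t ω).fst
        - ηx • (G (point 𝒴 G ηx ηy x₀ y₀ ξ t ω) (ξ t 0 ω)).fst)
      (proj 𝒴 ((point 𝒴 G ηx ηy x₀ y₀ ξ t ω).snd
        + ηy • (G (point 𝒴 G ηx ηy x₀ y₀ ξ t ω) (ξ t 0 ω)).snd)) :=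
  step_one G ηx ηy _ _

theorem point_snd_mem (h : NonconvexConcave f 𝒴 ℓ L D) (hy₀ : y₀ ∈ 𝒴) (t : ℕ) (ω : Ω) :
    (point 𝒴 G ηx ηy x₀ y₀ ξ t ω).snd ∈ 𝒴 := by
  cases t with
  | zero => exact hy₀
  | succ t => rw [point_succ]; exact (proj_spec h.nonempty h.closed _).1

variable [mΞ : MeasurableSpace Ξ] {P : Measure Ξ}

/-- The `σ`-algebra generated by the samples of the first `t` iterations. -/
@[reducible]
def past (ξ : ℕ → Fin 1 → Ω → Ξ) (t : ℕ) : MeasurableSpace Ω :=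
  ⨆ p ∈ {p : ℕ × Fin 1 | p.1 < t}, MeasurableSpace.comap (ξ p.1 p.2) mΞ

theorem past_mono {s t : ℕ} (hst : s ≤ t) : past ξ s ≤ past ξ t :=
  biSup_mono fun _ hp => lt_of_lt_of_le hp hst

theorem measurable_sample_past (t : ℕ) : Measurable[past ξ (t + 1)] (ξ t 0) := by
  rw [measurable_iff_comap_le]
  exact le_iSup₂_of_le (f := fun (p : ℕ × Fin 1) (_ : p ∈ {p : ℕ × Fin 1 | p.1 < t + 1}) =>
    MeasurableSpace.comap (ξ p.1 p.2) mΞ) (t, 0) (Nat.lt_succ_self t) le_rfl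

theorem measurable_fst_pair : Measurable fun z : Pair m n => z.fst :=
  (WithLp.prod_continuous_ofLp 2 (Vec m) (Vec n)).fst.measurable

theorem measurable_snd_pair : Measurable fun z : Pair m n => z.snd :=
  (WithLp.prod_continuous_ofLp 2 (Vec m) (Vec n)).snd.measurable

theorem measurable_mk : Measurable fun q : Vec m × Vec n => mk q.1 q.2 :=
  continuous_mk.measurable

theorem point_measurable_past (h : NonconvexConcave f 𝒴 ℓ L D) (hG : IsOracle P f G σ) (t : ℕ) :
    Measurable[past ξ t] (point 𝒴 G ηx ηy x₀ y₀ ξ t) := by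
  induction t with
  | zero => exact measurable_const
  | succ t ih =>
    have hz : Measurable[past ξ (t + 1)] (point 𝒴 G ηx ηy x₀ y₀ ξ t) :=
      ih.mono (past_mono (Nat.le_succ t)) le_rfl
    have hg : Measurable[past ξ (t + 1)]
        fun ω => G (point 𝒴 G ηx ηy x₀ y₀ ξ t ω) (ξ t 0 ω) :=
      hG.measurable.comp (hz.prodMk (measurable_sample_past t))
    have e : point 𝒴 G ηx ηy x₀ y₀ ξ (t + 1) = _ := funext (point_succ t)
    rw [e]
    refine measurable_mk.comp (Measurable.prodMk ?_ ?_)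
    · exact (measurable_fst_pair.comp hz).sub ((measurable_fst_pair.comp hg).const_smul ηx)
    · exact (continuous_proj h.nonempty h.closed h.convex).measurable.comp
        ((measurable_snd_pair.comp hz).add ((measurable_snd_pair.comp hg).const_smul ηy))

variable [mΩ : MeasurableSpace Ω] {μ : Measure Ω}

theorem past_le (hξ : ∀ t i, Measurable (ξ t i)) (t : ℕ) : past ξ t ≤ mΩ :=
  iSup₂_le fun p _ => (hξ p.1 p.2).comap_le

theorem indepFun_of_measurable_past {β : Type*} [MeasurableSpace β] (hR : IsRun μ P ξ T τ)
    {t : ℕ} {U : Ω → β} (hU : Measurable[past ξ t] U) : IndepFun U (ξ t 0) μ := by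
  have h1 : iIndep (fun p : ℕ × Fin 1 => MeasurableSpace.comap (ξ p.1 p.2) mΞ) μ :=
    hR.indep.iIndep
  have hdisj : Disjoint {p : ℕ × Fin 1 | p.1 < t} {p : ℕ × Fin 1 | p.1 = t} :=
    Set.disjoint_left.2 fun p hp hp' => (ne_of_lt hp) hp'
  have h2 := indep_iSup_of_disjoint (fun p => (hR.measurable p.1 p.2).comap_le) h1 hdisj
  refine (IndepFun_iff_Indep _ _ _).2 (indep_of_indep_of_le_left
    (indep_of_indep_of_le_right h2 ?_) hU.comap_le)
  exact le_iSup₂_of_le (f := fun (p : ℕ × Fin 1) (_ : p ∈ {p : ℕ × Fin 1 | p.1 = t}) =>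
    MeasurableSpace.comap (ξ p.1 p.2) mΞ) (t, 0) rfl le_rfl

/-- Measurable near-maximizers of `f(x, ·)` over `𝒴`: the first nearly optimal point of a dense
sequence. They stand in for a maximizer, whose measurable dependence on `x` is less elementary. -/
theorem exists_measurable_near_argmax (h : NonconvexConcave f 𝒴 ℓ L D) {κ : ℝ} (hκ : 0 < κ) :
    ∃ c : Vec m → Vec n, Measurable c ∧ (∀ x, c x ∈ 𝒴) ∧
      ∀ x, maxFun f 𝒴 x - f (mk x (c x)) ≤ κ := by
  classical
  have : Nonempty 𝒴 := h.nonempty.to_subtype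
  have hex : ∀ x, ∃ k : ℕ,
      maxFun f 𝒴 x - κ < f (mk x (TopologicalSpace.denseSeq 𝒴 k : Vec n)) := by
    intro x
    by_contra! hcon
    have hall : ∀ y : 𝒴, f (mk x (y : Vec n)) ≤ maxFun f 𝒴 x - κ := by
      have hcl : IsClosed {y : 𝒴 | f (mk x (y : Vec n)) ≤ maxFun f 𝒴 x - κ} :=
        isClosed_le ((continuous_slice h x).comp continuous_subtype_val) continuous_const
      exact isClosed_property (TopologicalSpace.denseRange_denseSeq 𝒴) hcl hcon
    have := maxFun_le h (x := x) fun y hy => hall ⟨y, hy⟩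
    linarith
  refine ⟨fun x => TopologicalSpace.denseSeq 𝒴 (Nat.find (hex x)), ?_, fun x => Subtype.coe_prop _,
    fun x => by linarith [Nat.find_spec (hex x)]⟩
  refine measurable_subtype_coe.comp ((measurable_from_nat (f := TopologicalSpace.denseSeq 𝒴)).comp
    (measurable_find hex fun k => ?_))
  refine measurableSet_lt ((continuous_maxFun h).measurable.sub_const κ) ?_
  exact (h.smooth.continuous.comp
    (continuous_mk.comp (Continuous.prodMk_left _))).measurable

end History

/-! ### Expected progress along a trajectory -/

section Trajectory

variable {m n : ℕ} {f : Pair m n → ℝ} {𝒴 : Set (Vec n)} {ℓ L D σ ηx ηy A κ : ℝ}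
  {Ω : Type*} [mΩ : MeasurableSpace Ω] {μ : Measure Ω}
  {z₀ : Pair m n} {ℱ : ℕ → MeasurableSpace Ω} {Z N : ℕ → Ω → Pair m n}

/-- A trajectory of stochastic gradient descent ascent: the iterates `Z` are adapted to `ℱ`, start
at `z₀` and follow the gradient of `f` perturbed by the noise `N`, which has second moment at most
`σ²` and is orthogonal to every bounded variable known before it is drawn. -/
structure IsTrajectory (μ : Measure Ω) (f : Pair m n → ℝ) (𝒴 : Set (Vec n)) (σ ηx ηy : ℝ)
    (z₀ : Pair m n) (ℱ : ℕ → MeasurableSpace Ω) (Z N : ℕ → Ω → Pair m n) : Prop where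
  intro ::
  le : ∀ t, ℱ t ≤ mΩ
  mono : Monotone ℱ
  adapted : ∀ t, Measurable[ℱ t] (Z t)
  initial : ∀ ω, Z 0 ω = z₀
  snd_mem : ∀ t ω, (Z t ω).snd ∈ 𝒴
  succ_fst : ∀ t ω, (Z (t + 1) ω).fst = (Z t ω).fst - ηx • ((∇ f (Z t ω)).fst + (N t ω).fst)
  succ_snd : ∀ t ω, (Z (t + 1) ω).snd =
    proj 𝒴 ((Z t ω).snd + ηy • ((∇ f (Z t ω)).snd + (N t ω).snd))
  noise_sq_integrable : ∀ t, Integrable (fun ω => ‖N t ω‖ ^ 2) μ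
  noise_sq_le : ∀ t, ∫ ω, ‖N t ω‖ ^ 2 ∂μ ≤ σ ^ 2
  noise_mean : ∀ (t : ℕ) (U : Ω → Pair m n) (R : ℝ), Measurable[ℱ t] U → (∀ ω, ‖U ω‖ ≤ R) →
    Integrable (fun ω => inner ℝ (U ω) (N t ω)) μ ∧ ∫ ω, inner ℝ (U ω) (N t ω) ∂μ = 0

theorem integral_le_of_le {F g : Ω → ℝ} {b : ℝ} (hF : Integrable F μ) (hg : Integrable g μ)
    (hle : ∀ ω, F ω ≤ g ω) (hb : ∫ ω, g ω ∂μ ≤ b) : ∫ ω, F ω ∂μ ≤ b :=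
  (integral_mono hF hg hle).trans hb

namespace IsTrajectory

theorem measurable (hZ : IsTrajectory μ f 𝒴 σ ηx ηy z₀ ℱ Z N) (t : ℕ) : Measurable (Z t) :=
  (hZ.adapted t).mono (hZ.le t) le_rfl

theorem measurable_fst (hZ : IsTrajectory μ f 𝒴 σ ηx ηy z₀ ℱ Z N) (t : ℕ) :
    Measurable fun ω => (Z t ω).fst :=
  measurable_fst_pair.comp (hZ.measurable t)

theorem measurable_snd (hZ : IsTrajectory μ f 𝒴 σ ηx ηy z₀ ℱ Z N) (t : ℕ) :
    Measurable fun ω => (Z t ω).snd :=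
  measurable_snd_pair.comp (hZ.measurable t)

variable [IsProbabilityMeasure μ]

/-- A step in `x` has expected length at most `η_x √(L² + σ²)`. -/
theorem integral_norm_step_le (hZ : IsTrajectory μ f 𝒴 σ ηx ηy z₀ ℱ Z N)
    (h : NonconvexConcave f 𝒴 ℓ L D) (hL : 0 ≤ L) (hS : 0 < L ^ 2 + σ ^ 2) (hη : 0 ≤ ηx) (t : ℕ) :
    Integrable (fun ω => ‖(Z (t + 1) ω).fst - (Z t ω).fst‖) μ ∧
      ∫ ω, ‖(Z (t + 1) ω).fst - (Z t ω).fst‖ ∂μ ≤ ηx * √(L ^ 2 + σ ^ 2) := by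
  set S := √(L ^ 2 + σ ^ 2) with hSdef
  have hSpos : 0 < S := Real.sqrt_pos.2 hS
  have hSsq : S ^ 2 = L ^ 2 + σ ^ 2 := Real.sq_sqrt hS.le
  set U : Ω → Pair m n := fun ω => mk (∇ f (Z t ω)).fst 0 with hU
  have hg : ∀ ω, ‖(∇ f (Z t ω)).fst‖ ≤ L := fun ω =>
    norm_gradient_fst_le h hL (Z t ω).fst (hZ.snd_mem t ω)
  have hUm : Measurable[ℱ t] U :=
    measurable_mk.comp (((measurable_fst_pair.comp h.smooth.continuous_gradient.measurable).comp
      (hZ.adapted t)).prodMk measurable_const)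
  obtain ⟨hi, h0⟩ := hZ.noise_mean t U L hUm fun ω => by
    rw [hU, norm_mk_zero_right]; exact hg ω
  set b : Ω → ℝ := fun ω =>
    ηx * ((L ^ 2 + 2 * inner ℝ (U ω) (N t ω) + ‖N t ω‖ ^ 2) / (2 * S) + S / 2) with hb
  have i1 : Integrable (fun ω => L ^ 2 + 2 * inner ℝ (U ω) (N t ω)) μ :=
    (integrable_const _).add (hi.const_mul 2)
  have i2 : Integrable (fun ω => (L ^ 2 + 2 * inner ℝ (U ω) (N t ω) + ‖N t ω‖ ^ 2) / (2 * S)) μ :=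
    (i1.add (hZ.noise_sq_integrable t)).div_const _
  have hbi : Integrable b μ := (i2.add (integrable_const _)).const_mul ηx
  -- Young's inequality with weight `S` replaces the square root of the second moment.
  have hle : ∀ ω, ‖(Z (t + 1) ω).fst - (Z t ω).fst‖ ≤ b ω := by
    intro ω
    rw [hZ.succ_fst, sub_sub_cancel_left, norm_neg, norm_smul, Real.norm_of_nonneg hη]
    refine mul_le_mul_of_nonneg_left ?_ hη
    set v := (∇ f (Z t ω)).fst + (N t ω).fst with hv
    have h1 : ‖v‖ ^ 2 ≤ L ^ 2 + 2 * inner ℝ (U ω) (N t ω) + ‖N t ω‖ ^ 2 := by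
      rw [hv, norm_add_sq_real, hU]
      have e : inner ℝ (mk (∇ f (Z t ω)).fst (0 : Vec n)) (N t ω)
          = inner ℝ (∇ f (Z t ω)).fst (N t ω).fst := by
        rw [mk_inner, inner_zero_left, add_zero]
      rw [e]
      have h2 := hg ω
      have h3 := norm_fst_le (N t ω)
      gcongr
    have h2 : ‖v‖ ≤ ‖v‖ ^ 2 / (2 * S) + S / 2 := by
      have h3 : ‖v‖ ^ 2 / (2 * S) + S / 2 - ‖v‖ = (‖v‖ - S) ^ 2 / (2 * S) := by
        field_simp; ring
      have h4 : 0 ≤ (‖v‖ - S) ^ 2 / (2 * S) := by positivity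
      linarith
    refine h2.trans ?_
    gcongr
  have hint : Integrable (fun ω => ‖(Z (t + 1) ω).fst - (Z t ω).fst‖) μ :=
    hbi.mono' ((hZ.measurable_fst (t + 1)).sub (hZ.measurable_fst t)).norm.aestronglyMeasurable
      (Filter.Eventually.of_forall fun ω => by rw [norm_norm]; exact hle ω)
  refine ⟨hint, integral_le_of_le hint hbi hle ?_⟩
  have hbe : ∫ ω, b ω ∂μ = ηx * ((L ^ 2 + ∫ ω, ‖N t ω‖ ^ 2 ∂μ) / (2 * S) + S / 2) := by
    rw [hb, integral_const_mul, integral_add i2 (integrable_const _), integral_div,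
      integral_add i1 (hZ.noise_sq_integrable t),
      integral_add (integrable_const (L ^ 2)) (hi.const_mul 2), integral_const_mul, h0]
    simp
  rw [hbe]
  refine mul_le_mul_of_nonneg_left ?_ hη
  have h1 := hZ.noise_sq_le t
  calc (L ^ 2 + ∫ ω, ‖N t ω‖ ^ 2 ∂μ) / (2 * S) + S / 2 ≤ S ^ 2 / (2 * S) + S / 2 := by
        gcongr; linarith
    _ = S := by field_simp; ring

theorem integral_norm_sub_le (hZ : IsTrajectory μ f 𝒴 σ ηx ηy z₀ ℱ Z N)
    (h : NonconvexConcave f 𝒴 ℓ L D) (hL : 0 ≤ L) (hS : 0 < L ^ 2 + σ ^ 2) (hη : 0 ≤ ηx)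
    (s k : ℕ) :
    Integrable (fun ω => ‖(Z (s + k) ω).fst - (Z s ω).fst‖) μ ∧
      ∫ ω, ‖(Z (s + k) ω).fst - (Z s ω).fst‖ ∂μ ≤ k * (ηx * √(L ^ 2 + σ ^ 2)) := by
  induction k with
  | zero => simp
  | succ k ih =>
    obtain ⟨h1, h2⟩ := hZ.integral_norm_step_le h hL hS hη (s + k)
    have hle : ∀ ω, ‖(Z (s + (k + 1)) ω).fst - (Z s ω).fst‖ ≤
        ‖(Z (s + k + 1) ω).fst - (Z (s + k) ω).fst‖ + ‖(Z (s + k) ω).fst - (Z s ω).fst‖ :=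
      fun ω => norm_sub_le_norm_sub_add_norm_sub _ _ _
    have hint : Integrable (fun ω => ‖(Z (s + (k + 1)) ω).fst - (Z s ω).fst‖) μ :=
      (h1.add ih.1).mono'
        ((hZ.measurable_fst _).sub (hZ.measurable_fst s)).norm.aestronglyMeasurable
        (Filter.Eventually.of_forall fun ω => by rw [norm_norm]; exact hle ω)
    refine ⟨hint, integral_le_of_le hint (h1.add ih.1) hle ?_⟩
    rw [integral_add' h1 ih.1]
    push_cast
    linarith [ih.2]

theorem integrable_norm_sub_initial (hZ : IsTrajectory μ f 𝒴 σ ηx ηy z₀ ℱ Z N)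
    (h : NonconvexConcave f 𝒴 ℓ L D) (hL : 0 ≤ L) (hS : 0 < L ^ 2 + σ ^ 2) (hη : 0 ≤ ηx) (t : ℕ) :
    Integrable (fun ω => ‖(Z t ω).fst - z₀.fst‖) μ := by
  have := (hZ.integral_norm_sub_le h hL hS hη 0 t).1
  simpa only [zero_add, hZ.initial] using this

theorem integrable_gap (hZ : IsTrajectory μ f 𝒴 σ ηx ηy z₀ ℱ Z N)
    (h : NonconvexConcave f 𝒴 ℓ L D) (hL : 0 ≤ L) (hS : 0 < L ^ 2 + σ ^ 2) (hη : 0 ≤ ηx) (t : ℕ) :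
    Integrable (fun ω => gap f 𝒴 (Z t ω)) μ := by
  obtain ⟨y₁, -, hy₁⟩ := (isCompact_domain h).exists_isMinOn h.nonempty
    (continuous_slice h z₀.fst).continuousOn
  refine ((integrable_const (maxFun f 𝒴 z₀.fst - f (mk z₀.fst y₁))).add
    ((hZ.integrable_norm_sub_initial h hL hS hη t).const_mul (2 * L))).mono' ?_
    (Filter.Eventually.of_forall fun ω => ?_)
  · exact (((continuous_maxFun h).measurable.comp (hZ.measurable_fst t)).sub
      (h.smooth.continuous.measurable.comp (hZ.measurable t))).aestronglyMeasurable
  · rw [Real.norm_of_nonneg (gap_nonneg h (hZ.snd_mem t ω))]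
    have h1 : maxFun f 𝒴 (Z t ω).fst ≤ f (Z t ω) + (maxFun f 𝒴 z₀.fst - f (mk z₀.fst y₁)
        + 2 * L * ‖(Z t ω).fst - z₀.fst‖) := by
      refine maxFun_le h fun w hw => ?_
      have h2 := driftBound_lipschitz h z₀.fst (Z t ω).fst w hw _ (hZ.snd_mem t ω)
      rw [mk_eta] at h2
      have h3 : f (mk z₀.fst y₁) ≤ f (mk z₀.fst (Z t ω).snd) := hy₁ (hZ.snd_mem t ω)
      linarith [le_maxFun h z₀.fst hw]
    have e : gap f 𝒴 (Z t ω) = maxFun f 𝒴 (Z t ω).fst - f (Z t ω) := rfl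
    rw [e]
    show _ ≤ maxFun f 𝒴 z₀.fst - f (mk z₀.fst y₁) + 2 * L * ‖(Z t ω).fst - z₀.fst‖
    linarith

theorem integrable_dist_sq (hZ : IsTrajectory μ f 𝒴 σ ηx ηy z₀ ℱ Z N)
    (h : NonconvexConcave f 𝒴 ℓ L D) {c : Ω → Vec n} (hc : Measurable c) (hmem : ∀ ω, c ω ∈ 𝒴)
    (t : ℕ) : Integrable (fun ω => ‖(Z t ω).snd - c ω‖ ^ 2) μ := by
  refine Integrable.of_bound
    (((hZ.measurable_snd t).sub hc).norm.pow_const 2).aestronglyMeasurable (D ^ 2)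
    (Filter.Eventually.of_forall fun ω => ?_)
  rw [Real.norm_of_nonneg (by positivity)]
  have := norm_sub_le_diam h (hZ.snd_mem t ω) (hmem ω)
  gcongr

/-- One step of the gap recursion inside a block that starts at time `s`, with a comparator `c`
chosen at time `s`. -/
theorem integral_gap_succ_le (hZ : IsTrajectory μ f 𝒴 σ ηx ηy z₀ ℱ Z N)
    (h : NonconvexConcave f 𝒴 ℓ L D) (hL : 0 ≤ L) (hS : 0 < L ^ 2 + σ ^ 2) (hη : 0 ≤ ηx)
    (hηy : 0 < ηy) (hηℓ : ηy * ℓ ≤ 1 / 2) (hA0 : 0 ≤ A) (hA : DriftBound f 𝒴 A) {s : ℕ}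
    {c : Ω → Vec n} (hc : Measurable[ℱ s] c) (hmem : ∀ ω, c ω ∈ 𝒴)
    (hκ : ∀ ω, maxFun f 𝒴 (Z s ω).fst - f (mk (Z s ω).fst (c ω)) ≤ κ) (k : ℕ) :
    ∫ ω, gap f 𝒴 (Z (s + k + 1) ω) ∂μ ≤
      κ + A * ((2 * k + 1) * (ηx * √(L ^ 2 + σ ^ 2)))
        + (∫ ω, ‖(Z (s + k) ω).snd - c ω‖ ^ 2 ∂μ - ∫ ω, ‖(Z (s + k + 1) ω).snd - c ω‖ ^ 2 ∂μ)
          / (2 * ηy) + ηy * σ ^ 2 := by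
  have hcm : Measurable c := hc.mono (hZ.le s) le_rfl
  have hct : Measurable[ℱ (s + k)] c := hc.mono (hZ.mono (Nat.le_add_right s k)) le_rfl
  set U : Ω → Pair m n := fun ω => mk 0 ((Z (s + k) ω).snd - c ω) with hU
  have hUm : Measurable[ℱ (s + k)] U := measurable_mk.comp
    (measurable_const.prodMk ((measurable_snd_pair.comp (hZ.adapted (s + k))).sub hct))
  obtain ⟨hi, h0⟩ := hZ.noise_mean (s + k) U D hUm fun ω => by
    rw [hU, norm_mk_zero_left]; exact norm_sub_le_diam h (hZ.snd_mem _ ω) (hmem ω)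
  obtain ⟨hx1, hx1'⟩ := hZ.integral_norm_sub_le h hL hS hη s (k + 1)
  obtain ⟨hx2, hx2'⟩ := hZ.integral_norm_sub_le h hL hS hη s k
  have hy1 := hZ.integrable_dist_sq h hcm hmem (s + k)
  have hy2 := hZ.integrable_dist_sq h hcm hmem (s + k + 1)
  have hn := hZ.noise_sq_integrable (s + k)
  have hle : ∀ ω, gap f 𝒴 (Z (s + k + 1) ω) ≤
      κ + A * ‖(Z (s + (k + 1)) ω).fst - (Z s ω).fst‖ + A * ‖(Z (s + k) ω).fst - (Z s ω).fst‖
        + (‖(Z (s + k) ω).snd - c ω‖ ^ 2 - ‖(Z (s + k + 1) ω).snd - c ω‖ ^ 2) / (2 * ηy)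
        + inner ℝ (U ω) (N (s + k) ω) + ηy * ‖N (s + k) ω‖ ^ 2 := by
    intro ω
    have h1 := ascent_step h hηy.le hηℓ (Z (s + k) ω).fst (Z (s + k) ω).snd (N (s + k) ω).snd
      (hmem ω) (hZ.succ_snd (s + k) ω)
    have h2 := gap_le_of_driftBound h hA (x := (Z (s + k) ω).fst)
      (x' := (Z (s + (k + 1)) ω).fst) (hZ.snd_mem (s + k + 1) ω) (hmem ω) (hκ ω)
    have e1 : mk (Z (s + (k + 1)) ω).fst (Z (s + k + 1) ω).snd = Z (s + k + 1) ω := rfl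
    rw [e1] at h2
    have e2 : inner ℝ (U ω) (N (s + k) ω)
        = inner ℝ (N (s + k) ω).snd ((Z (s + k) ω).snd - c ω) := by
      rw [hU, mk_inner, inner_zero_left, zero_add, real_inner_comm]
    rw [e2]
    have h3 := norm_snd_le (N (s + k) ω)
    have h4 : ηy * ‖(N (s + k) ω).snd‖ ^ 2 ≤ ηy * ‖N (s + k) ω‖ ^ 2 := by gcongr
    have h5 : f (mk (Z (s + k) ω).fst (c ω)) - f (mk (Z (s + k) ω).fst (Z (s + k + 1) ω).snd) ≤
        (‖(Z (s + k) ω).snd - c ω‖ ^ 2 - ‖(Z (s + k + 1) ω).snd - c ω‖ ^ 2) / (2 * ηy)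
        + inner ℝ (N (s + k) ω).snd ((Z (s + k) ω).snd - c ω)
        + ηy * ‖(N (s + k) ω).snd‖ ^ 2 := by
      rw [← sub_nonneg] at h1 ⊢
      refine (div_nonneg h1 (by positivity : 0 ≤ 2 * ηy)).trans_eq ?_
      field_simp
    linarith
  have i1 := (integrable_const (μ := μ) κ).add (hx1.const_mul A)
  have i2 := i1.add (hx2.const_mul A)
  have i3 := i2.add ((hy1.sub hy2).div_const (2 * ηy))
  have i4 := i3.add hi
  refine integral_le_of_le (hZ.integrable_gap h hL hS hη _) (i4.add (hn.const_mul ηy)) hle ?_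
  rw [integral_add' i4 (hn.const_mul ηy), integral_add' i3 hi,
    integral_add' i2 ((hy1.sub hy2).div_const (2 * ηy)), integral_add' i1 (hx2.const_mul A),
    integral_add' (integrable_const κ) (hx1.const_mul A), h0]
  simp only [integral_const_mul, integral_div, Pi.sub_apply]
  rw [integral_sub hy1 hy2]
  simp only [integral_const, probReal_univ, smul_eq_mul, one_mul]
  have h1 := mul_le_mul_of_nonneg_left hx1' hA0
  have h2 := mul_le_mul_of_nonneg_left hx2' hA0
  have h3 := mul_le_mul_of_nonneg_left (hZ.noise_sq_le (s + k)) hηy.le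
  push_cast at h1
  linarith

/-- The gaps accumulated over a block of `B` steps. -/
theorem sum_gap_block_le (hZ : IsTrajectory μ f 𝒴 σ ηx ηy z₀ ℱ Z N)
    (h : NonconvexConcave f 𝒴 ℓ L D) (hL : 0 ≤ L) (hS : 0 < L ^ 2 + σ ^ 2) (hη : 0 ≤ ηx)
    (hηy : 0 < ηy) (hηℓ : ηy * ℓ ≤ 1 / 2) (hA0 : 0 ≤ A) (hA : DriftBound f 𝒴 A) {s : ℕ}
    {c : Ω → Vec n} (hc : Measurable[ℱ s] c) (hmem : ∀ ω, c ω ∈ 𝒴)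
    (hκ : ∀ ω, maxFun f 𝒴 (Z s ω).fst - f (mk (Z s ω).fst (c ω)) ≤ κ) {R : ℝ}
    (hR : ∀ ω, ‖(Z s ω).snd - c ω‖ ^ 2 ≤ R) (B : ℕ) :
    ∑ k ∈ Finset.range B, ∫ ω, gap f 𝒴 (Z (s + k + 1) ω) ∂μ ≤
      A * (ηx * √(L ^ 2 + σ ^ 2)) * (B : ℝ) ^ 2 + R / (2 * ηy) + B * (ηy * σ ^ 2 + κ) := by
  have hcm : Measurable c := hc.mono (hZ.le s) le_rfl
  have key : ∀ B : ℕ, ∑ k ∈ Finset.range B, ∫ ω, gap f 𝒴 (Z (s + k + 1) ω) ∂μ ≤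
      A * (ηx * √(L ^ 2 + σ ^ 2)) * (B : ℝ) ^ 2
        + (R - ∫ ω, ‖(Z (s + B) ω).snd - c ω‖ ^ 2 ∂μ) / (2 * ηy) + B * (ηy * σ ^ 2 + κ) := by
    intro B
    induction B with
    | zero =>
      have h1 : ∫ ω, ‖(Z s ω).snd - c ω‖ ^ 2 ∂μ ≤ R :=
        integral_le_of_le (hZ.integrable_dist_sq h hcm hmem s) (integrable_const R) hR (by simp)
      have h2 : 0 ≤ (R - ∫ ω, ‖(Z s ω).snd - c ω‖ ^ 2 ∂μ) / (2 * ηy) :=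
        div_nonneg (sub_nonneg.2 h1) (by positivity)
      simpa using h2
    | succ B ih =>
      rw [Finset.sum_range_succ]
      have h1 := hZ.integral_gap_succ_le h hL hS hη hηy hηℓ hA0 hA hc hmem hκ B
      rw [← add_assoc s B 1]
      push_cast
      rw [sub_div] at h1 ih ⊢
      linarith
  refine (key B).trans ?_
  have h1 : 0 ≤ ∫ ω, ‖(Z (s + B) ω).snd - c ω‖ ^ 2 ∂μ := integral_nonneg fun ω => by positivity
  gcongr
  linarith

/-- The gaps accumulated over `T ≤ k B` steps, cut into `k` blocks of length at most `B`. In each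
block the comparator is a near-maximizer at the beginning of the block. -/
theorem sum_gap_le (hZ : IsTrajectory μ f 𝒴 σ ηx ηy z₀ ℱ Z N)
    (h : NonconvexConcave f 𝒴 ℓ L D) (hL : 0 ≤ L) (hS : 0 < L ^ 2 + σ ^ 2) (hη : 0 ≤ ηx)
    (hηy : 0 < ηy) (hηℓ : ηy * ℓ ≤ 1 / 2) (hA0 : 0 ≤ A) (hA : DriftBound f 𝒴 A) (hκ : 0 < κ)
    (B k : ℕ) : ∀ T : ℕ, T ≤ k * B →
    ∑ t ∈ Finset.range T, ∫ ω, gap f 𝒴 (Z (t + 1) ω) ∂μ ≤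
      T * (A * (ηx * √(L ^ 2 + σ ^ 2)) * B + ηy * σ ^ 2 + κ) + k * (D ^ 2 / (2 * ηy)) := by
  obtain ⟨c, hcm, hcmem, hcκ⟩ := exists_measurable_near_argmax h hκ
  have hD2 : 0 ≤ D ^ 2 / (2 * ηy) := by positivity
  induction k with
  | zero => intro T hT; simp at hT; simp [hT]
  | succ k ih =>
    intro T hT
    rcases le_or_gt T (k * B) with hle | hlt
    · refine (ih T hle).trans ?_
      push_cast
      linarith
    · obtain ⟨r, rfl⟩ := Nat.exists_eq_add_of_lt hlt
      have hr : r + 1 ≤ B := by rw [add_mul] at hT; omega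
      have h1 := ih (k * B) le_rfl
      have h2 := hZ.sum_gap_block_le h hL hS hη hηy hηℓ hA0 hA (s := k * B)
        (c := fun ω => c (Z (k * B) ω).fst)
        ((hcm.comp measurable_fst_pair).comp (hZ.adapted (k * B))) (fun ω => hcmem _)
        (fun ω => hcκ _) (R := D ^ 2) (fun ω => by
          have := norm_sub_le_diam h (hZ.snd_mem (k * B) ω) (hcmem (Z (k * B) ω).fst)
          gcongr) (r + 1)
      rw [show k * B + r + 1 = k * B + (r + 1) by ring, Finset.sum_range_add]
      have h3 : A * (ηx * √(L ^ 2 + σ ^ 2)) * ((r + 1 : ℕ) : ℝ) ^ 2 ≤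
          A * (ηx * √(L ^ 2 + σ ^ 2)) * (((r + 1 : ℕ) : ℝ) * B) := by
        rw [sq ((r + 1 : ℕ) : ℝ)]
        have : ((r + 1 : ℕ) : ℝ) ≤ B := by exact_mod_cast hr
        gcongr
      push_cast at h1 h2 h3 ⊢
      linarith

/-- Descent of the expected Moreau envelope. -/
theorem integral_moreau_succ_le (hZ : IsTrajectory μ f 𝒴 σ ηx ηy z₀ ℱ Z N)
    (h : NonconvexConcave f 𝒴 ℓ L D) (hℓ : 0 < ℓ) (hL : 0 ≤ L) (hS : 0 < L ^ 2 + σ ^ 2)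
    (hη : 0 ≤ ηx) (hb : BddBelow (Set.range (maxFun f 𝒴))) {p : Vec m → Vec m}
    (hp : ∀ x, IsProx ℓ (maxFun f 𝒴) x (p x)) (hpc : Continuous p) (t : ℕ) :
    Integrable (fun ω => moreau (1 / (2 * ℓ)) (maxFun f 𝒴) (Z t ω).fst) μ ∧
    ∫ ω, moreau (1 / (2 * ℓ)) (maxFun f 𝒴) (Z (t + 1) ω).fst ∂μ ≤
      ∫ ω, moreau (1 / (2 * ℓ)) (maxFun f 𝒴) (Z t ω).fst ∂μ
        + 2 * ℓ * ηx * ∫ ω, gap f 𝒴 (Z t ω) ∂μ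
        - 2 * ℓ ^ 2 * ηx * ∫ ω, ‖(Z t ω).fst - p (Z t ω).fst‖ ^ 2 ∂μ
        + ℓ * ηx ^ 2 * (L ^ 2 + σ ^ 2) := by
  set V := moreau (1 / (2 * ℓ)) (maxFun f 𝒴) with hV
  have hVc : Continuous V := continuous_iff_continuousAt.2 fun x =>
    (hasGradientAt_moreau hℓ (isWeaklyConvex_maxFun h) hb hp x).differentiableAt.continuousAt
  have hpd : ∀ x, 2 * ℓ * ‖x - p x‖ ≤ 4 / 3 * L := fun x =>
    (hp x).norm_sub_le_of_lipschitz hℓ hL (isWeaklyConvex_maxFun h) (abs_maxFun_sub_le h)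
  have hVi : ∀ t, Integrable (fun ω => V (Z t ω).fst) μ := by
    intro t
    obtain ⟨b, hb'⟩ := id hb
    refine ((integrable_const (|b| + |maxFun f 𝒴 z₀.fst|)).add
      ((hZ.integrable_norm_sub_initial h hL hS hη t).const_mul L)).mono'
      (hVc.measurable.comp (hZ.measurable_fst t)).aestronglyMeasurable
      (Filter.Eventually.of_forall fun ω => ?_)
    set x := (Z t ω).fst with hx
    have h1 := moreau_le hℓ hb x x
    rw [sub_self, norm_zero, ← hV] at h1
    have h2 := (abs_le.1 (abs_maxFun_sub_le h x z₀.fst)).2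
    have h3 := (hp x).moreau_eq hℓ hb
    rw [← hV] at h3
    have h4 : b ≤ maxFun f 𝒴 (p x) := hb' ⟨p x, rfl⟩
    have h5 : 0 ≤ ℓ * ‖p x - x‖ ^ 2 := by positivity
    have h6 : 0 ≤ L * ‖x - z₀.fst‖ := by positivity
    show ‖V x‖ ≤ |b| + |maxFun f 𝒴 z₀.fst| + L * ‖x - z₀.fst‖
    rw [Real.norm_eq_abs, abs_le]
    constructor
    · linarith [neg_abs_le b, abs_nonneg (maxFun f 𝒴 z₀.fst)]
    · linarith [le_abs_self (maxFun f 𝒴 z₀.fst), abs_nonneg b]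
  refine ⟨hVi t, ?_⟩
  set W : Vec m → Vec n → Vec m := fun x y =>
    (2 * ℓ * ηx) • (p x - x) + (2 * ℓ * ηx ^ 2) • (∇ f (mk x y)).fst with hW
  set U : Ω → Pair m n := fun ω => mk (W (Z t ω).fst (Z t ω).snd) 0 with hU
  have hWm : Measurable fun z : Pair m n => W z.fst z.snd := by
    have h1 : Measurable fun z : Pair m n => p z.fst - z.fst :=
      (hpc.measurable.comp measurable_fst_pair).sub measurable_fst_pair
    have h2 : Measurable fun z : Pair m n => (∇ f z).fst :=
      measurable_fst_pair.comp h.smooth.continuous_gradient.measurable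
    exact (h1.const_smul (2 * ℓ * ηx)).add (h2.const_smul (2 * ℓ * ηx ^ 2))
  have hUm : Measurable[ℱ t] U :=
    measurable_mk.comp ((hWm.comp (hZ.adapted t)).prodMk measurable_const)
  obtain ⟨hi, h0⟩ := hZ.noise_mean t U (ηx * (4 / 3 * L) + 2 * ℓ * ηx ^ 2 * L) hUm fun ω => by
    rw [hU, norm_mk_zero_right, hW]
    refine (norm_add_le _ _).trans ?_
    rw [norm_smul, norm_smul, Real.norm_of_nonneg (by positivity),
      Real.norm_of_nonneg (by positivity), norm_sub_rev]
    have h1 := mul_le_mul_of_nonneg_left (hpd (Z t ω).fst) hη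
    have h2 := mul_le_mul_of_nonneg_left
      (norm_gradient_fst_le h hL (Z t ω).fst (hZ.snd_mem t ω))
      (by positivity : 0 ≤ 2 * ℓ * ηx ^ 2)
    linarith
  have hg := hZ.integrable_gap h hL hS hη t
  have hn := hZ.noise_sq_integrable t
  have hq : Integrable (fun ω => ‖(Z t ω).fst - p (Z t ω).fst‖ ^ 2) μ := by
    refine Integrable.of_bound (((hZ.measurable_fst t).sub
      (hpc.measurable.comp (hZ.measurable_fst t))).norm.pow_const 2).aestronglyMeasurable
      ((4 / 3 * L / (2 * ℓ)) ^ 2) (Filter.Eventually.of_forall fun ω => ?_)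
    rw [Real.norm_of_nonneg (by positivity)]
    have : ‖(Z t ω).fst - p (Z t ω).fst‖ ≤ 4 / 3 * L / (2 * ℓ) := by
      rw [le_div_iff₀ (by positivity), mul_comm]; exact hpd _
    gcongr
  have i1 := (hVi t).add (hg.const_mul (2 * ℓ * ηx))
  have i2 := i1.sub (hq.const_mul (2 * ℓ ^ 2 * ηx))
  have i3 := i2.add hi
  have i4 := ((integrable_const (μ := μ) (L ^ 2)).add hn).const_mul (ℓ * ηx ^ 2)
  refine integral_le_of_le (hVi (t + 1)) (i3.add i4) (fun ω => ?_) ?_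
  · have h1 := descent_step h hℓ hL hb hη (d := (N t ω).fst) (hZ.snd_mem t ω) (hp (Z t ω).fst)
    rw [mk_eta, ← hZ.succ_fst, ← hV] at h1
    have e1 : inner ℝ (U ω) (N t ω) = inner ℝ (W (Z t ω).fst (Z t ω).snd) (N t ω).fst := by
      rw [hU, mk_inner, inner_zero_left, add_zero]
    have e2 : W (Z t ω).fst (Z t ω).snd = (2 * ℓ * ηx) • (p (Z t ω).fst - (Z t ω).fst)
      + (2 * ℓ * ηx ^ 2) • (∇ f (Z t ω)).fst := rfl
    rw [← e2, ← e1] at h1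
    have h2 := norm_fst_le (N t ω)
    have h3 : ℓ * ηx ^ 2 * (L ^ 2 + ‖(N t ω).fst‖ ^ 2) ≤ ℓ * ηx ^ 2 * (L ^ 2 + ‖N t ω‖ ^ 2) := by
      gcongr
    exact h1.trans (by simpa [gap] using h3)
  · rw [integral_add' i3 i4, integral_add' i2 hi, integral_sub' i1 (hq.const_mul _),
      integral_add' (hVi t) (hg.const_mul _), h0]
    simp only [integral_const_mul, Pi.add_apply]
    rw [integral_add (integrable_const _) hn]
    simp only [integral_const, probReal_univ, one_smul]
    have h3 := mul_le_mul_of_nonneg_left (hZ.noise_sq_le t) (by positivity : 0 ≤ ℓ * ηx ^ 2)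
    linarith

end IsTrajectory
end Trajectory

/-! ### Averaging over a trajectory -/

section Average

variable {m n : ℕ} {f : Pair m n → ℝ} {𝒴 : Set (Vec n)} {ℓ L D σ ηx ηy ε K A : ℝ}
  {Ω : Type*} [mΩ : MeasurableSpace Ω] {μ : Measure Ω} [IsProbabilityMeasure μ]
  {z₀ : Pair m n} {ℱ : ℕ → MeasurableSpace Ω} {Z N : ℕ → Ω → Pair m n}

/-- Telescoping the descent of the envelope over `T + 1` steps and dropping the gradient at the
starting point, which is not among the possible outputs. -/
theorem IsTrajectory.sum_dist_prox_le (hZ : IsTrajectory μ f 𝒴 σ ηx ηy z₀ ℱ Z N)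
    (h : NonconvexConcave f 𝒴 ℓ L D) (hℓ : 0 < ℓ) (hL : 0 ≤ L) (hS : 0 < L ^ 2 + σ ^ 2)
    (hη : 0 ≤ ηx) (hb : BddBelow (Set.range (maxFun f 𝒴))) {p : Vec m → Vec m}
    (hp : ∀ x, IsProx ℓ (maxFun f 𝒴) x (p x)) (hpc : Continuous p) (T : ℕ) :
    2 * ℓ ^ 2 * ηx * ∑ t ∈ Finset.range T,
        ∫ ω, ‖(Z (t + 1) ω).fst - p (Z (t + 1) ω).fst‖ ^ 2 ∂μ ≤
      deltaPhi f 𝒴 ℓ z₀.fst + 2 * ℓ * ηx * (gap f 𝒴 z₀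
        + ∑ t ∈ Finset.range T, ∫ ω, gap f 𝒴 (Z (t + 1) ω) ∂μ)
        + (T + 1) * (ℓ * ηx ^ 2 * (L ^ 2 + σ ^ 2)) := by
  set V := moreau (1 / (2 * ℓ)) (maxFun f 𝒴) with hV
  have key : ∀ k : ℕ, ∫ ω, V (Z k ω).fst ∂μ
      + 2 * ℓ ^ 2 * ηx * ∑ t ∈ Finset.range k, ∫ ω, ‖(Z t ω).fst - p (Z t ω).fst‖ ^ 2 ∂μ ≤
      V z₀.fst + 2 * ℓ * ηx * ∑ t ∈ Finset.range k, ∫ ω, gap f 𝒴 (Z t ω) ∂μ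
        + k * (ℓ * ηx ^ 2 * (L ^ 2 + σ ^ 2)) := by
    intro k
    induction k with
    | zero => simp [hZ.initial]
    | succ k ih =>
      have h1 := (hZ.integral_moreau_succ_le h hℓ hL hS hη hb hp hpc k).2
      rw [Finset.sum_range_succ, Finset.sum_range_succ]
      push_cast
      linarith
  have h1 := key (T + 1)
  rw [Finset.sum_range_succ', Finset.sum_range_succ'] at h1
  have hbV : BddBelow (Set.range V) := bddBelow_range_moreau hℓ hb hp
  have h2 : ⨅ x, V x ≤ ∫ ω, V (Z (T + 1) ω).fst ∂μ := by
    refine le_trans (by simp) (integral_mono (integrable_const (⨅ x, V x))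
      (hZ.integral_moreau_succ_le h hℓ hL hS hη hb hp hpc (T + 1)).1 fun ω => ciInf_le hbV _)
  have h3 : 0 ≤ 2 * ℓ ^ 2 * ηx * ∫ ω, ‖(Z 0 ω).fst - p (Z 0 ω).fst‖ ^ 2 ∂μ :=
    mul_nonneg (by positivity) (integral_nonneg fun ω => by positivity)
  have h4 : ∫ ω, gap f 𝒴 (Z 0 ω) ∂μ = gap f 𝒴 z₀ := by simp [hZ.initial]
  have h5 : deltaPhi f 𝒴 ℓ z₀.fst = V z₀.fst - ⨅ x, V x := rfl
  rw [h4] at h1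
  rw [h5]
  push_cast at h1
  linarith

/-- The total gap when the drift over a block of length `B` and the cost of the `k` comparators are
both small. Here `K` is the ratio `ℓ D² / (η_y ε²)`. -/
theorem IsTrajectory.sum_gap_le_of_blocks (hZ : IsTrajectory μ f 𝒴 σ ηx ηy z₀ ℱ Z N)
    (h : NonconvexConcave f 𝒴 ℓ L D) (hℓ : 0 < ℓ) (hL : 0 ≤ L) (hS : 0 < L ^ 2 + σ ^ 2)
    (hε : 0 < ε) (hη : 0 ≤ ηx) (hηy : 0 < ηy) (hy₁ : ηy * (2 * ℓ) ≤ 1)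
    (hy₂ : ηy * (16 * ℓ * σ ^ 2) ≤ ε ^ 2) (hK : K * (ηy * ε ^ 2) = ℓ * D ^ 2) (hA0 : 0 ≤ A)
    (hA : DriftBound f 𝒴 A) {T B k : ℕ}
    (hdrift : 4 * ℓ * (A * (ηx * √(L ^ 2 + σ ^ 2)) * B) ≤ ε ^ 2 / 16) (hk : T ≤ k * B)
    (hkK : 2 * k * K ≤ T / 4) :
    4 * ℓ * ∑ t ∈ Finset.range T, ∫ ω, gap f 𝒴 (Z (t + 1) ω) ∂μ ≤ 5 / 8 * (T * ε ^ 2) := by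
  have hκ : 0 < ε ^ 2 / (64 * ℓ) := by positivity
  have hκ' : 4 * ℓ * (ε ^ 2 / (64 * ℓ)) = ε ^ 2 / 16 := by field_simp; norm_num
  have hdist : 4 * ℓ * (D ^ 2 / (2 * ηy)) = 2 * K * ε ^ 2 := by
    field_simp
    linarith
  have hsum := hZ.sum_gap_le h hL hS hη hηy (by linarith) hA0 hA hκ B k T hk
  have h1 := mul_le_mul_of_nonneg_left hsum (by positivity : 0 ≤ 4 * ℓ)
  have h2 : 4 * ℓ * (T * (A * (ηx * √(L ^ 2 + σ ^ 2)) * B + ηy * σ ^ 2 + ε ^ 2 / (64 * ℓ))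
      + k * (D ^ 2 / (2 * ηy)))
      = T * (4 * ℓ * (A * (ηx * √(L ^ 2 + σ ^ 2)) * B) + 4 * ℓ * ηy * σ ^ 2
        + 4 * ℓ * (ε ^ 2 / (64 * ℓ))) + k * (4 * ℓ * (D ^ 2 / (2 * ηy))) := by ring
  rw [h2, hdist, hκ'] at h1
  have h3 := mul_le_mul_of_nonneg_right hkK (sq_nonneg ε)
  have h4 : T * (4 * ℓ * (A * (ηx * √(L ^ 2 + σ ^ 2)) * B) + 4 * ℓ * ηy * σ ^ 2 + ε ^ 2 / 16)
      ≤ T * (3 / 8 * ε ^ 2) := by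
    refine mul_le_mul_of_nonneg_left ?_ (Nat.cast_nonneg T)
    linarith
  linarith

/-- The total gap over a single block whose comparator is the starting point itself: no distance
term appears, but the initial gap is paid at every step. -/
theorem IsTrajectory.sum_gap_le_of_initial (hZ : IsTrajectory μ f 𝒴 σ ηx ηy z₀ ℱ Z N)
    (h : NonconvexConcave f 𝒴 ℓ L D) (hℓ : 0 < ℓ) (hL : 0 ≤ L) (hS : 0 < L ^ 2 + σ ^ 2)
    (hη : 0 ≤ ηx) (hηy : 0 < ηy) (hy₁ : ηy * (2 * ℓ) ≤ 1)
    (hy₂ : ηy * (16 * ℓ * σ ^ 2) ≤ ε ^ 2) (hA0 : 0 ≤ A) (hA : DriftBound f 𝒴 A) {T : ℕ}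
    (hdrift : 4 * ℓ * (A * (ηx * √(L ^ 2 + σ ^ 2)) * T) ≤ ε ^ 2 / 16)
    (hΔ : 64 * ℓ * gap f 𝒴 z₀ ≤ ε ^ 2) :
    4 * ℓ * ∑ t ∈ Finset.range T, ∫ ω, gap f 𝒴 (Z (t + 1) ω) ∂μ ≤ 5 / 8 * (T * ε ^ 2) := by
  have : Nonempty Ω := nonempty_of_isProbabilityMeasure μ
  have hz₀ : z₀.snd ∈ 𝒴 := by
    have := hZ.snd_mem 0 (Classical.arbitrary Ω)
    rwa [hZ.initial] at this
  have hsum := hZ.sum_gap_block_le h hL hS hη hηy (by linarith) hA0 hA (s := 0)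
    (c := fun _ => z₀.snd) (κ := gap f 𝒴 z₀) (R := 0) measurable_const (fun _ => hz₀)
    (fun ω => by rw [hZ.initial]; exact le_rfl) (fun ω => by simp [hZ.initial]) T
  simp only [zero_add] at hsum
  have h1 := mul_le_mul_of_nonneg_left hsum (by positivity : 0 ≤ 4 * ℓ)
  have h2 : 4 * ℓ * (A * (ηx * √(L ^ 2 + σ ^ 2)) * (T : ℝ) ^ 2 + 0 / (2 * ηy)
      + T * (ηy * σ ^ 2 + gap f 𝒴 z₀))
      = T * (4 * ℓ * (A * (ηx * √(L ^ 2 + σ ^ 2)) * T) + 4 * ℓ * ηy * σ ^ 2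
        + 4 * ℓ * gap f 𝒴 z₀) := by ring
  rw [h2] at h1
  have h4 : T * (4 * ℓ * (A * (ηx * √(L ^ 2 + σ ^ 2)) * T) + 4 * ℓ * ηy * σ ^ 2
      + 4 * ℓ * gap f 𝒴 z₀) ≤ T * (5 / 8 * ε ^ 2) := by
    refine mul_le_mul_of_nonneg_left ?_ (Nat.cast_nonneg T)
    linarith [sq_nonneg ε]
  linarith

/-- The total gap under the stepsize conditions. When `K = ℓ D² / (η_y ε²)` is small, blocks of
length one and the drift constant `ℓ D` are used, otherwise blocks of length about `16 K` and the
drift constant `2 L`. -/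
theorem IsTrajectory.sum_gap_le_of_stepsize (hZ : IsTrajectory μ f 𝒴 σ ηx ηy z₀ ℱ Z N)
    (h : NonconvexConcave f 𝒴 ℓ L D) (hℓ : 0 < ℓ) (hL : 0 ≤ L) (hS : 0 < L ^ 2 + σ ^ 2)
    (hε : 0 < ε) (hεL : ε < 4 / 3 * L) (hη : 0 ≤ ηx) (hηy : 0 < ηy)
    (hx₁ : ηx * (16 * ℓ * (L ^ 2 + σ ^ 2)) ≤ ε ^ 2)
    (hx₂ : ηx * (4096 * ℓ * L * √(L ^ 2 + σ ^ 2) * K) ≤ ε ^ 2)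
    (hy₁ : ηy * (2 * ℓ) ≤ 1) (hy₂ : ηy * (16 * ℓ * σ ^ 2) ≤ ε ^ 2)
    (hK : K * (ηy * ε ^ 2) = ℓ * D ^ 2) {T : ℕ}
    (hTK : 2 ^ 17 * (ℓ * gap f 𝒴 z₀ / ε ^ 2) * K ≤ T) :
    4 * ℓ * ∑ t ∈ Finset.range T, ∫ ω, gap f 𝒴 (Z (t + 1) ω) ∂μ ≤ 5 / 8 * (T * ε ^ 2) := by
  have hSsq : √(L ^ 2 + σ ^ 2) ^ 2 = L ^ 2 + σ ^ 2 := Real.sq_sqrt hS.le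
  have hD : 0 ≤ D := h.diam ▸ Metric.diam_nonneg
  have hT0 : (0 : ℝ) ≤ T := Nat.cast_nonneg T
  have hK0 : 0 ≤ K := by
    by_contra! hneg
    have h1 : K * (ηy * ε ^ 2) < 0 := mul_neg_of_neg_of_pos hneg (by positivity)
    have h2 : 0 ≤ ℓ * D ^ 2 := by positivity
    linarith
  rcases le_or_gt K (1 / 16) with hKs | hKl
  · refine hZ.sum_gap_le_of_blocks h hℓ hL hS hε hη hηy hy₁ hy₂ hK (A := ℓ * D) (B := 1) (k := T)
      (by positivity) (driftBound_diam h hℓ.le) ?_ (by simp) ?_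
    -- Here `(ℓ D)² = K ε² η_y ℓ ≤ ε² / 32`, and `ε < 4L / 3` makes this at most a sixteenth of
    -- `L² + σ²`, so that the drift is bounded through `η_x (L² + σ²)` alone.
    · have hdiam : ℓ * D ≤ √(L ^ 2 + σ ^ 2) / 4 := by
        have e : (ℓ * D) ^ 2 = K * ε ^ 2 * (ηy * ℓ) := by linear_combination -ℓ * hK
        have h2 : K * ε ^ 2 * (ηy * ℓ) ≤ 1 / 16 * ε ^ 2 * (1 / 2) := by
          gcongr; linarith
        have h3 : ε ^ 2 ≤ (4 / 3 * L) ^ 2 := by gcongr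
        refine (sq_le_sq₀ (by positivity) (by positivity)).1 ?_
        linarith [sq_nonneg σ]
      have h1 : 4 * ℓ * (ℓ * D * (ηx * √(L ^ 2 + σ ^ 2))) ≤
          4 * ℓ * (√(L ^ 2 + σ ^ 2) / 4 * (ηx * √(L ^ 2 + σ ^ 2))) := by gcongr
      have h2 : 4 * ℓ * (√(L ^ 2 + σ ^ 2) / 4 * (ηx * √(L ^ 2 + σ ^ 2)))
          = ℓ * ηx * √(L ^ 2 + σ ^ 2) ^ 2 := by ring
      rw [hSsq] at h2
      rw [Nat.cast_one, mul_one]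
      linarith
    · linarith [mul_le_mul_of_nonneg_left hKs hT0]
  · set B := ⌈16 * K⌉₊ with hB
    have hB1 : 16 * K ≤ B := Nat.le_ceil _
    have hB2 : (B : ℝ) < 16 * K + 1 := Nat.ceil_lt_add_one (by positivity)
    have hBpos : 0 < B := Nat.ceil_pos.2 (by positivity)
    have hdrift : 4 * ℓ * (2 * L * (ηx * √(L ^ 2 + σ ^ 2)) * B) ≤ ε ^ 2 / 16 := by
      have h1 : 4 * ℓ * (2 * L * (ηx * √(L ^ 2 + σ ^ 2)) * B) ≤
          4 * ℓ * (2 * L * (ηx * √(L ^ 2 + σ ^ 2)) * (32 * K)) := by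
        -- The rounding in `B < 16 K + 1` is absorbed since `16 K > 1`.
        gcongr; linarith
      linarith
    rcases le_or_gt B T with hBT | hBT
    -- The number `T / B + 1` of blocks is at most `2 T / B`.
    · have hk : T ≤ (T / B + 1) * B := by
        rw [add_mul, one_mul]
        have h1 := Nat.div_add_mod T B
        have h2 := Nat.mod_lt T hBpos
        rw [mul_comm] at h1
        omega
      have hk2 : (T / B + 1) * B ≤ 2 * T := by
        have := Nat.div_mul_le_self T B
        rw [add_mul]; omega
      refine hZ.sum_gap_le_of_blocks h hℓ hL hS hε hη hηy hy₁ hy₂ hK (by positivity)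
        (driftBound_lipschitz h) hdrift hk ?_
      have hk2' : ((T / B + 1 : ℕ) : ℝ) * B ≤ 2 * T := by exact_mod_cast hk2
      have h1 : ((T / B + 1 : ℕ) : ℝ) * (16 * K) ≤ ((T / B + 1 : ℕ) : ℝ) * B := by gcongr
      linarith
    · rcases le_or_gt (64 * ℓ * gap f 𝒴 z₀) (ε ^ 2) with hΔ | hΔ
      · refine hZ.sum_gap_le_of_initial h hℓ hL hS hη hηy hy₁ hy₂ (by positivity)
          (driftBound_lipschitz h) (le_trans ?_ hdrift) hΔ
        have hBT' : (T : ℝ) ≤ B := by exact_mod_cast hBT.le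
        gcongr
      · refine hZ.sum_gap_le_of_blocks h hℓ hL hS hε hη hηy hy₁ hy₂ hK (k := 1) (by positivity)
          (driftBound_lipschitz h) hdrift (by omega) ?_
        have h1 : 1 / 64 ≤ ℓ * gap f 𝒴 z₀ / ε ^ 2 := by
          rw [le_div_iff₀ (by positivity)]; linarith
        have h2 := mul_le_mul_of_nonneg_right h1 hK0
        push_cast
        linarith

end Average

/-! ### The algorithm and its output -/

section Output

variable {m n : ℕ} {f : Pair m n → ℝ} {𝒴 : Set (Vec n)} {ℓ L D σ ηx ηy ε : ℝ}
  {Ω Ξ : Type*} [mΞ : MeasurableSpace Ξ] [mΩ : MeasurableSpace Ω] {P : Measure Ξ}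
  {μ : Measure Ω} [IsProbabilityMeasure μ]
  {G : Pair m n → Ξ → Pair m n} {x₀ : Vec m} {y₀ : Vec n}
  {ξ : ℕ → Fin 1 → Ω → Ξ} {T : ℕ} {τ : Ω → ℕ}

/-- The expectation at the random index `τ` is the average of the expectations over `1, …, T`. -/
theorem IsRun.integral_index (hR : IsRun μ P ξ T τ) (hT : 1 ≤ T) {g : ℕ → Ω → ℝ} {b : ℝ}
    (hg : ∀ t, Measurable[past ξ t] (g t)) (hb : ∀ t ω, |g t ω| ≤ b) :
    Integrable (fun ω => g (τ ω) ω) μ ∧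
      ∫ ω, g (τ ω) ω ∂μ = (∑ t ∈ Finset.range T, ∫ ω, g (t + 1) ω ∂μ) / T := by
  have hT0 : (T : ℝ) ≠ 0 := by positivity
  have hpast : ∀ t, past ξ t ≤ MeasurableSpace.comap
      (fun ω (p : ℕ × Fin 1) => ξ p.1 p.2 ω) MeasurableSpace.pi := fun t =>
    iSup₂_le fun p _ => by
      rw [← measurable_iff_comap_le]
      exact (measurable_pi_apply (X := fun _ : ℕ × Fin 1 => Ξ) p).comp (comap_measurable _)
  have hgm : ∀ t, Measurable (g t) := fun t => (hg t).mono (past_le hR.measurable t) le_rfl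
  have hgi : ∀ t, Integrable (g t) μ := fun t =>
    Integrable.of_bound (hgm t).aestronglyMeasurable b (Filter.Eventually.of_forall (hb t))
  have hset : ∀ t : ℕ, MeasurableSet (τ ⁻¹' {t}) := fun t =>
    hR.measurable_index (measurableSet_singleton t)
  set χ : ℕ → Ω → ℝ := fun t => (τ ⁻¹' {t}).indicator 1 with hχ
  have hχe : ∀ t, χ t = (({t} : Set ℕ).indicator (1 : ℕ → ℝ)) ∘ τ := fun t => by
    ext ω; by_cases hω : τ ω = t <;> simp [hχ, hω]
  have hχm : ∀ t, Measurable (χ t) := fun t => measurable_one.indicator (hset t)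
  have hind : ∀ t, IndepFun (χ t) (g t) μ := fun t => by
    rw [IndepFun_iff_Indep]
    refine indep_of_indep_of_le_left (indep_of_indep_of_le_right
      ((IndepFun_iff_Indep _ _ _).1 hR.indep_index) ((hg t).comap_le.trans (hpast t))) ?_
    rw [hχe, ← measurable_iff_comap_le]
    exact (measurable_from_nat).comp (comap_measurable τ)
  have hmulint : ∀ t, Integrable (fun ω => χ t ω * g t ω) μ := fun t => by
    have : (fun ω => χ t ω * g t ω) = (τ ⁻¹' {t}).indicator (g t) := by
      ext ω; by_cases hω : ω ∈ τ ⁻¹' {t} <;> simp [hχ, hω]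
    rw [this]
    exact (hgi t).indicator (hset t)
  have hmul : ∀ t ∈ Finset.Icc 1 T, ∫ ω, χ t ω * g t ω ∂μ = (∫ ω, g t ω ∂μ) / T := by
    intro t ht
    rw [(hind t).integral_fun_mul_eq_mul_integral (hχm t).aestronglyMeasurable
      (hgm t).aestronglyMeasurable, hχ, integral_indicator_one (hset t), hR.uniform_index t ht]
    ring
  have hae : ∀ᵐ ω ∂μ, τ ω ∈ Finset.Icc 1 T := by
    have h1 : μ.real (⋃ t ∈ Finset.Icc 1 T, τ ⁻¹' {t}) = 1 := by
      rw [measureReal_biUnion_finset (fun i _ j _ hij => Disjoint.preimage _ (by simpa using hij))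
        (fun t _ => hset t), Finset.sum_congr rfl hR.uniform_index]
      simp [hT0]
    have h2 : MeasurableSet (⋃ t ∈ Finset.Icc 1 T, τ ⁻¹' {t}) :=
      Finset.measurableSet_biUnion _ fun t _ => hset t
    have h3 : μ (⋃ t ∈ Finset.Icc 1 T, τ ⁻¹' {t}) = 1 := by
      rw [← ENNReal.toReal_eq_one_iff]; exact h1
    have h4 := (mem_ae_iff_prob_eq_one h2).2 h3
    filter_upwards [h4] with ω hω
    simpa using hω
  have hsum : (fun ω => ∑ t ∈ Finset.Icc 1 T, χ t ω * g t ω) =ᵐ[μ] fun ω => g (τ ω) ω := by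
    filter_upwards [hae] with ω hω
    rw [Finset.sum_eq_single_of_mem (τ ω) hω fun t _ ht => by
      have : ω ∉ τ ⁻¹' {t} := fun h => ht (Set.mem_singleton_iff.1 h).symm
      simp [hχ, this]]
    simp [hχ]
  have hint : Integrable (fun ω => ∑ t ∈ Finset.Icc 1 T, χ t ω * g t ω) μ :=
    integrable_finsetSum _ fun t _ => hmulint t
  refine ⟨hint.congr hsum, ?_⟩
  rw [← integral_congr_ae hsum, integral_finsetSum _ fun t _ => hmulint t,
    Finset.sum_congr rfl hmul, ← Finset.sum_div, Finset.range_eq_Ico,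
    Finset.sum_Ico_add' (fun t => ∫ ω, g t ω ∂μ) 0 T 1]
  rfl

/-- A bound on the mean squared envelope gradients, averaged over the iterates, is a bound at the
randomly chosen iterate. -/
theorem isStationary_of_sum_le (h : NonconvexConcave f 𝒴 ℓ L D) (hℓ : 0 < ℓ) (hL : 0 ≤ L)
    (hε : 0 < ε) (hb : BddBelow (Set.range (maxFun f 𝒴))) (hG : IsOracle P f G σ)
    (hR : IsRun μ P ξ T τ) (hT : 1 ≤ T) {p : Vec m → Vec m}
    (hp : ∀ x, IsProx ℓ (maxFun f 𝒴) x (p x)) (hpc : Continuous p)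
    (hsum : 4 * ℓ ^ 2 * ∑ t ∈ Finset.range T, ∫ ω,
      ‖(point 𝒴 G ηx ηy x₀ y₀ ξ (t + 1) ω).fst - p (point 𝒴 G ηx ηy x₀ y₀ ξ (t + 1) ω).fst‖ ^ 2 ∂μ
        ≤ T * ε ^ 2) :
    IsStationary μ ℓ ε (maxFun f 𝒴) (output 𝒴 G ηx ηy x₀ y₀ ξ τ) := by
  have hgrad := hasGradientAt_moreau hℓ (isWeaklyConvex_maxFun h) hb hp
  have hT0 : (0 : ℝ) < T := by exact_mod_cast hT
  have hnorm : ∀ x, ‖∇ (moreau (1 / (2 * ℓ)) (maxFun f 𝒴)) x‖ = 2 * ℓ * ‖x - p x‖ := fun x => by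
    rw [(hgrad x).gradient, norm_smul, Real.norm_of_nonneg (by positivity)]
  have hle : ∀ x, 2 * ℓ * ‖x - p x‖ ≤ 4 / 3 * L := fun x =>
    (hp x).norm_sub_le_of_lipschitz hℓ hL (isWeaklyConvex_maxFun h) (abs_maxFun_sub_le h)
  have hmeas : ∀ t, Measurable[past ξ t] fun ω => 2 * ℓ *
      ‖(point 𝒴 G ηx ηy x₀ y₀ ξ t ω).fst - p (point 𝒴 G ηx ηy x₀ y₀ ξ t ω).fst‖ := fun t => by
    have h1 : Measurable fun x => 2 * ℓ * ‖x - p x‖ :=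
      ((continuous_id.sub hpc).norm.const_mul (2 * ℓ)).measurable
    exact h1.comp (measurable_fst_pair.comp (point_measurable_past h hG t))
  obtain ⟨h1, -⟩ := hR.integral_index hT hmeas (b := 4 / 3 * L) fun t ω => by
    rw [abs_of_nonneg (by positivity)]; exact hle _
  obtain ⟨h2, h2'⟩ := hR.integral_index hT (fun t => (hmeas t).pow_const 2) (b := (4 / 3 * L) ^ 2)
    fun t ω => by
      rw [abs_of_nonneg (by positivity)]
      have := hle (point 𝒴 G ηx ηy x₀ y₀ ξ t ω).fst
      gcongr
  have e1 : (fun ω => ‖∇ (moreau (1 / (2 * ℓ)) (maxFun f 𝒴)) (output 𝒴 G ηx ηy x₀ y₀ ξ τ ω)‖)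
      = fun ω => 2 * ℓ * ‖(point 𝒴 G ηx ηy x₀ y₀ ξ (τ ω) ω).fst
        - p (point 𝒴 G ηx ηy x₀ y₀ ξ (τ ω) ω).fst‖ := funext fun ω => hnorm _
  have e2 : (fun ω => ‖∇ (moreau (1 / (2 * ℓ)) (maxFun f 𝒴)) (output 𝒴 G ηx ηy x₀ y₀ ξ τ ω)‖ ^ 2)
      = fun ω => (2 * ℓ * ‖(point 𝒴 G ηx ηy x₀ y₀ ξ (τ ω) ω).fst
        - p (point 𝒴 G ηx ηy x₀ y₀ ξ (τ ω) ω).fst‖) ^ 2 := by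
    funext ω; rw [congrFun e1 ω]
  have hsq : ∫ ω, (2 * ℓ * ‖(point 𝒴 G ηx ηy x₀ y₀ ξ (τ ω) ω).fst
        - p (point 𝒴 G ηx ηy x₀ y₀ ξ (τ ω) ω).fst‖) ^ 2 ∂μ ≤ ε ^ 2 := by
    rw [h2', div_le_iff₀ hT0]
    simp only [mul_pow, integral_const_mul, ← Finset.mul_sum]
    linarith
  unfold IsStationary
  rw [e1, e2]
  refine ⟨fun x => (hgrad x).differentiableAt, h2, hsq, h1, ?_⟩
  -- Jensen's inequality, in the form `2 a ε ≤ a² + ε²`.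
  refine integral_le_of_le h1 ((h2.add (integrable_const (ε ^ 2))).const_mul (1 / (2 * ε)))
    (fun ω => ?_) ?_
  · set a := 2 * ℓ * ‖(point 𝒴 G ηx ηy x₀ y₀ ξ (τ ω) ω).fst
        - p (point 𝒴 G ηx ηy x₀ y₀ ξ (τ ω) ω).fst‖ with ha
    show a ≤ 1 / (2 * ε) * (a ^ 2 + ε ^ 2)
    rw [one_div, inv_mul_eq_div, le_div_iff₀ (by positivity)]
    nlinarith [sq_nonneg (a - ε)]
  · rw [integral_const_mul, integral_add' h2 (integrable_const _)]
    simp only [integral_const, probReal_univ, one_smul]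
    rw [one_div, inv_mul_le_iff₀ (by positivity)]
    linarith

variable [IsProbabilityMeasure P]

/-- The iterates of the algorithm form a trajectory with respect to the history of the samples. -/
theorem isTrajectory_point (h : NonconvexConcave f 𝒴 ℓ L D) (hG : IsOracle P f G σ)
    (hy₀ : y₀ ∈ 𝒴) (hR : IsRun μ P ξ T τ) :
    IsTrajectory μ f 𝒴 σ ηx ηy (mk x₀ y₀) (past ξ) (point 𝒴 G ηx ηy x₀ y₀ ξ)
      (fun t ω => G (point 𝒴 G ηx ηy x₀ y₀ ξ t ω) (ξ t 0 ω)
        - ∇ f (point 𝒴 G ηx ηy x₀ y₀ ξ t ω)) := by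
  have had := fun t => point_measurable_past (ηx := ηx) (ηy := ηy) (x₀ := x₀) (y₀ := y₀) (ξ := ξ)
    h hG t
  have hle := past_le hR.measurable
  have hm := fun t => (had t).mono (hle t) le_rfl
  have hsq := fun t => hG.noise_sq h.smooth (hm t) (hR.measurable t 0) (hR.law t 0)
    (indepFun_of_measurable_past hR (had t))
  have e : ∀ a b : Pair m n, b + (a - b) = a := fun a b => add_sub_cancel b a
  refine
    { le := hle
      mono := fun s t hst => past_mono hst
      adapted := had
      initial := fun ω => rfl
      snd_mem := point_snd_mem h hy₀
      succ_fst := fun t ω => ?_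
      succ_snd := fun t ω => ?_
      noise_sq_integrable := fun t => (hsq t).1
      noise_sq_le := fun t => (hsq t).2
      noise_mean := fun t U R hU hUR => hG.noise_mean h.smooth (hU.mono (hle t) le_rfl) (hm t)
        (hR.measurable t 0) (hR.law t 0) (indepFun_of_measurable_past hR (hU.prodMk (had t))) hUR }
  · rw [← WithLp.add_fst, e, point_succ]; rfl
  · rw [← WithLp.add_snd, e, point_succ]; rfl

/-- The envelope gradient at the output is small in mean square as soon as the number of iterations
exceeds the complexity bound, with the constant `2 ^ 21`. -/
theorem isStationary_output (h : NonconvexConcave f 𝒴 ℓ L D) (hℓ : 0 < ℓ) (hL : 0 ≤ L)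
    (hS : 0 < L ^ 2 + σ ^ 2) (hε : 0 < ε) (hb : BddBelow (Set.range (maxFun f 𝒴)))
    (hG : IsOracle P f G σ) (hy₀ : y₀ ∈ 𝒴) (hT : 1 ≤ T) (hR : IsRun μ P ξ T τ)
    (hTC : 2 ^ 21 * ((ℓ * (L ^ 2 + σ ^ 2) * deltaPhi f 𝒴 ℓ x₀ / ε ^ 4
      + ℓ * deltaZero f 𝒴 x₀ y₀ / ε ^ 2)
      * max 1 (max (ℓ ^ 2 * D ^ 2 / ε ^ 2) (ℓ ^ 2 * D ^ 2 * σ ^ 2 / ε ^ 4))) ≤ T) :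
    IsStationary μ ℓ ε (maxFun f 𝒴)
      (output 𝒴 G (etaX ℓ L σ D ε) (etaY ℓ σ ε) x₀ y₀ ξ τ) := by
  set S2 := L ^ 2 + σ ^ 2 with hS2
  set M := max 1 (max (ℓ ^ 2 * D ^ 2 / ε ^ 2) (ℓ ^ 2 * D ^ 2 * σ ^ 2 / ε ^ 4)) with hM
  have hM1 : 1 ≤ M := le_max_left _ _
  have hM2 : ℓ ^ 2 * D ^ 2 / ε ^ 2 ≤ M := (le_max_left _ _).trans (le_max_right _ _)
  have hM3 : ℓ ^ 2 * D ^ 2 * σ ^ 2 / ε ^ 4 ≤ M := (le_max_right _ _).trans (le_max_right _ _)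
  have hSsq : √S2 ^ 2 = S2 := Real.sq_sqrt hS.le
  have hLS : L * √S2 ≤ S2 := by
    have : L ≤ √S2 := Real.le_sqrt_of_sq_le (by rw [hS2]; linarith [sq_nonneg σ])
    calc L * √S2 ≤ √S2 * √S2 := by gcongr
      _ = S2 := by rw [← sq, hSsq]
  -- The inverse stepsizes.
  set X := max (16 * ℓ * S2 / ε ^ 2) (max (8192 * ℓ ^ 3 * D ^ 2 * L * √S2 / ε ^ 4)
    (65536 * ℓ ^ 3 * D ^ 2 * σ ^ 2 * L * √S2 / ε ^ 6)) with hX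
  set Y := max (2 * ℓ) (16 * ℓ * σ ^ 2 / ε ^ 2) with hY
  have hX1 : 16 * ℓ * S2 / ε ^ 2 ≤ X := le_max_left _ _
  have hX2 : 8192 * ℓ ^ 3 * D ^ 2 * L * √S2 / ε ^ 4 ≤ X :=
    (le_max_left _ _).trans (le_max_right _ _)
  have hX3 : 65536 * ℓ ^ 3 * D ^ 2 * σ ^ 2 * L * √S2 / ε ^ 6 ≤ X :=
    (le_max_right _ _).trans (le_max_right _ _)
  have hY1 : 2 * ℓ ≤ Y := le_max_left _ _
  have hY2 : 16 * ℓ * σ ^ 2 / ε ^ 2 ≤ Y := le_max_right _ _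
  have hXpos : 0 < X := lt_of_lt_of_le (by positivity) hX1
  have hYpos : 0 < Y := lt_of_lt_of_le (by positivity) hY1
  have hηx : etaX ℓ L σ D ε = 1 / X := rfl
  have hηy : etaY ℓ σ ε = 1 / Y := rfl
  rw [hηx, hηy]
  have hX4 : X ≤ 65536 * (ℓ * S2 / ε ^ 2) * M := by
    refine max_le ?_ (max_le ?_ ?_)
    · calc 16 * ℓ * S2 / ε ^ 2 = 16 * (ℓ * S2 / ε ^ 2) * 1 := by ring
        _ ≤ 65536 * (ℓ * S2 / ε ^ 2) * M := by gcongr; norm_num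
    · calc 8192 * ℓ ^ 3 * D ^ 2 * L * √S2 / ε ^ 4
          = 8192 * (ℓ * (L * √S2) / ε ^ 2) * (ℓ ^ 2 * D ^ 2 / ε ^ 2) := by field_simp
        _ ≤ 65536 * (ℓ * S2 / ε ^ 2) * M := by gcongr; norm_num
    · calc 65536 * ℓ ^ 3 * D ^ 2 * σ ^ 2 * L * √S2 / ε ^ 6
          = 65536 * (ℓ * (L * √S2) / ε ^ 2) * (ℓ ^ 2 * D ^ 2 * σ ^ 2 / ε ^ 4) := by field_simp
        _ ≤ 65536 * (ℓ * S2 / ε ^ 2) * M := by gcongr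
  set K := ℓ * D ^ 2 * Y / ε ^ 2 with hKdef
  -- `K` is the ratio `ℓ D² / (η_y ε²)`, which takes one of two forms according to the stepsize.
  have hK' : K = 2 * (ℓ ^ 2 * D ^ 2 / ε ^ 2) ∨ K = 16 * (ℓ ^ 2 * D ^ 2 * σ ^ 2 / ε ^ 4) := by
    rcases max_choice (2 * ℓ) (16 * ℓ * σ ^ 2 / ε ^ 2) with e | e
    · left; rw [hKdef, hY, e]; ring
    · right; rw [hKdef, hY, e]; field_simp
  have hKM : K ≤ 16 * M := by rcases hK' with e | e <;> rw [e] <;> linarith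
  have hKX : 4096 * ℓ * L * √S2 * K / ε ^ 2 ≤ X := by
    rcases hK' with e | e <;> rw [e]
    · refine le_of_eq_of_le ?_ hX2
      field_simp; ring
    · refine le_of_eq_of_le ?_ hX3
      field_simp; ring
  have hΔ0 : 0 ≤ deltaZero f 𝒴 x₀ y₀ := gap_nonneg h (z := mk x₀ y₀) hy₀
  choose p hp using exists_isProx (Φ := maxFun f 𝒴) hℓ (continuous_maxFun h) hb
  have hΔΦ : 0 ≤ deltaPhi f 𝒴 ℓ x₀ :=
    sub_nonneg.2 (ciInf_le (bddBelow_range_moreau hℓ hb hp) x₀)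
  have hpc : Continuous p := (LipschitzWith.of_dist_le' (K := 2) fun x x' => by
    rw [dist_eq_norm, dist_eq_norm]
    exact (hp x').norm_sub_le hℓ (isWeaklyConvex_maxFun h) (hp x)).continuous
  have hZ := isTrajectory_point (ηx := 1 / X) (ηy := 1 / Y) (x₀ := x₀) h hG hy₀ hR
  refine isStationary_of_sum_le h hℓ hL hε hb hG hR hT hp hpc ?_
  have hT0 : (1 : ℝ) ≤ T := by exact_mod_cast hT
  rcases le_or_gt (4 / 3 * L) ε with hεL | hεL
  · have hpt : ∀ t, ∫ ω, ‖(point 𝒴 G (1 / X) (1 / Y) x₀ y₀ ξ (t + 1) ω).fst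
        - p (point 𝒴 G (1 / X) (1 / Y) x₀ y₀ ξ (t + 1) ω).fst‖ ^ 2 ∂μ ≤ (ε / (2 * ℓ)) ^ 2 := by
      intro t
      refine (integral_mono_of_nonneg (Filter.Eventually.of_forall fun ω => by positivity)
        (integrable_const ((ε / (2 * ℓ)) ^ 2)) (Filter.Eventually.of_forall fun ω => ?_)).trans
        (by simp)
      have h1 := (hp (point 𝒴 G (1 / X) (1 / Y) x₀ y₀ ξ (t + 1) ω).fst).norm_sub_le_of_lipschitz
        hℓ hL (isWeaklyConvex_maxFun h) (abs_maxFun_sub_le h)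
      refine pow_le_pow_left₀ (norm_nonneg _) ?_ 2
      rw [le_div_iff₀ (by positivity)]
      linarith
    have h1 := Finset.sum_le_sum fun t (_ : t ∈ Finset.range T) => hpt t
    rw [Finset.sum_const, Finset.card_range, nsmul_eq_mul] at h1
    refine (mul_le_mul_of_nonneg_left h1 (by positivity : 0 ≤ 4 * ℓ ^ 2)).trans_eq ?_
    field_simp
    norm_num
  -- Error budget, in units of `ε²`: `5 / 8` for the gaps, `1 / 4` for the second-order term of the
  -- descent, and `1 / 16` each for `Δ̂_Φ` and `Δ̂_0`.
  · set a := ℓ * S2 * deltaPhi f 𝒴 ℓ x₀ / ε ^ 4 with ha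
    set b := ℓ * deltaZero f 𝒴 x₀ y₀ / ε ^ 2 with hbdef
    have ha0 : 0 ≤ a := by positivity
    have hb0 : 0 ≤ b := by positivity
    have haM : 2 ^ 21 * (a * M) ≤ T := by
      have : 0 ≤ b * M := by positivity
      linarith
    have hbM : 2 ^ 21 * (b * M) ≤ T := by
      have : 0 ≤ a * M := by positivity
      linarith
    have h1 := hZ.sum_dist_prox_le h hℓ hL hS (by positivity) hb hp hpc T
    have h2 := hZ.sum_gap_le_of_stepsize h hℓ hL hS hε hεL (by positivity) (by positivity)
      (K := K) (T := T)
      (by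
        rw [one_div, inv_mul_le_iff₀ hXpos]
        rwa [div_le_iff₀ (by positivity)] at hX1)
      (by
        rw [one_div, inv_mul_le_iff₀ hXpos]
        rwa [div_le_iff₀ (by positivity)] at hKX)
      (by rw [one_div, inv_mul_le_iff₀ hYpos]; linarith)
      (by
        rw [one_div, inv_mul_le_iff₀ hYpos]
        rwa [div_le_iff₀ (by positivity)] at hY2)
      (by rw [hKdef]; field_simp)
      (by
        have h3 : b * K ≤ b * (16 * M) := by gcongr
        have h4 : ℓ * gap f 𝒴 (mk x₀ y₀) / ε ^ 2 = b := rfl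
        rw [h4]
        linarith)
    have hgap : gap f 𝒴 (mk x₀ y₀) = deltaZero f 𝒴 x₀ y₀ := rfl
    have hx₀ : (mk x₀ y₀).fst = x₀ := rfl
    rw [hgap, hx₀] at h1
    have h3 := mul_le_mul_of_nonneg_left h1 (by positivity : 0 ≤ 2 * X)
    have e1 : ∀ q : ℝ, 2 * X * (2 * ℓ ^ 2 * (1 / X) * q) = 4 * ℓ ^ 2 * q := fun q => by
      field_simp; ring
    have e2 : ∀ q r s : ℝ, 2 * X * (q + 2 * ℓ * (1 / X) * r + s * (ℓ * (1 / X) ^ 2 * S2))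
        = 2 * X * q + 4 * ℓ * r + 2 * s * (ℓ * S2 / X) := fun q r s => by
      field_simp; ring
    rw [e1, e2] at h3
    refine h3.trans ?_
    have h4 : ℓ * S2 / X ≤ ε ^ 2 / 16 := by
      rw [div_le_iff₀ hXpos]
      rw [div_le_iff₀ (by positivity)] at hX1
      linarith
    have h5 : 2 * (T + 1) * (ℓ * S2 / X) ≤ 2 * (T + T) * (ε ^ 2 / 16) := by gcongr
    have h6 : X * deltaPhi f 𝒴 ℓ x₀ ≤ 65536 * (a * M) * ε ^ 2 := by
      have : X * deltaPhi f 𝒴 ℓ x₀ ≤ 65536 * (ℓ * S2 / ε ^ 2) * M * deltaPhi f 𝒴 ℓ x₀ := by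
        gcongr
      refine this.trans_eq ?_
      rw [ha]; field_simp
    have h7 := mul_le_mul_of_nonneg_right haM (sq_nonneg ε)
    have h8 : ℓ * deltaZero f 𝒴 x₀ y₀ = b * ε ^ 2 := by rw [hbdef]; field_simp
    have h9 : b * 1 * ε ^ 2 ≤ b * M * ε ^ 2 := by gcongr
    have h10 := mul_le_mul_of_nonneg_right hbM (sq_nonneg ε)
    linarith [mul_nonneg (by positivity : (0 : ℝ) ≤ T) (sq_nonneg ε)]

end Output

end SGDA

theorem mainTheorem4 :
    ∃ C : ℝ, 0 < C ∧
      ∀ (m n : ℕ) (f : SGDA.Pair m n → ℝ) (𝒴 : Set (SGDA.Vec n)) (ℓ L D σ ε : ℝ)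
        (Ξ : Type*) [MeasurableSpace Ξ] (P : Measure Ξ) [IsProbabilityMeasure P]
        (G : SGDA.Pair m n → Ξ → SGDA.Pair m n) (x₀ : SGDA.Vec m) (y₀ : SGDA.Vec n)
        (Ω : Type*) [MeasurableSpace Ω] (μ : Measure Ω) [IsProbabilityMeasure μ]
        (ξ : ℕ → Fin 1 → Ω → Ξ) (T : ℕ) (τ : Ω → ℕ),
        0 < ℓ → 0 ≤ L → 0 ≤ σ → 0 < L ^ 2 + σ ^ 2 → 0 < ε →
        SGDA.NonconvexConcave f 𝒴 ℓ L D →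
        BddBelow (Set.range (SGDA.maxFun f 𝒴)) →
        SGDA.IsOracle P f G σ →
        y₀ ∈ 𝒴 →
        1 ≤ T →
        SGDA.IsRun μ P ξ T τ →
        (C * ((ℓ * (L ^ 2 + σ ^ 2) * SGDA.deltaPhi f 𝒴 ℓ x₀ / ε ^ 4
              + ℓ * SGDA.deltaZero f 𝒴 x₀ y₀ / ε ^ 2)
            * max 1 (max (ℓ ^ 2 * D ^ 2 / ε ^ 2) (ℓ ^ 2 * D ^ 2 * σ ^ 2 / ε ^ 4))) ≤ T →
          SGDA.IsStationary μ ℓ ε (SGDA.maxFun f 𝒴)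
            (SGDA.output 𝒴 G (SGDA.etaX ℓ L σ D ε) (SGDA.etaY ℓ σ ε) x₀ y₀ ξ τ)) ∧
        (ε ≤ ℓ * D →
          C * ((ℓ ^ 3 * (L ^ 2 + σ ^ 2) * D ^ 2 * SGDA.deltaPhi f 𝒴 ℓ x₀ / ε ^ 6
              + ℓ ^ 3 * D ^ 2 * SGDA.deltaZero f 𝒴 x₀ y₀ / ε ^ 4)
            * max 1 (σ ^ 2 / ε ^ 2)) ≤ T →
          SGDA.IsStationary μ ℓ ε (SGDA.maxFun f 𝒴)
            (SGDA.output 𝒴 G (SGDA.etaX ℓ L σ D ε) (SGDA.etaY ℓ σ ε) x₀ y₀ ξ τ)) := by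
  refine ⟨2 ^ 21, by norm_num, ?_⟩
  intro m n f 𝒴 ℓ L D σ ε Ξ _ P _ G x₀ y₀ Ω _ μ _ ξ T τ hℓ hL hσ hS hε h hb hG hy₀ hT hR
  refine ⟨SGDA.isStationary_output h hℓ hL hS hε hb hG hy₀ hT hR, fun hεD hTC => ?_⟩
  refine SGDA.isStationary_output h hℓ hL hS hε hb hG hy₀ hT hR (le_of_eq_of_le ?_ hTC)
  -- For `ε ≤ ℓ D` the factor `ℓ² D² / ε² ≥ 1` can be taken out of the maximum.
  have h1 : 1 ≤ ℓ ^ 2 * D ^ 2 / ε ^ 2 := by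
    rw [one_le_div (by positivity), ← mul_pow]
    gcongr
  have h2 : ℓ ^ 2 * D ^ 2 * σ ^ 2 / ε ^ 4 = ℓ ^ 2 * D ^ 2 / ε ^ 2 * (σ ^ 2 / ε ^ 2) := by
    field_simp
  have h3 : max 1 (max (ℓ ^ 2 * D ^ 2 / ε ^ 2) (ℓ ^ 2 * D ^ 2 * σ ^ 2 / ε ^ 4))
      = ℓ ^ 2 * D ^ 2 / ε ^ 2 * max 1 (σ ^ 2 / ε ^ 2) := by
    rw [max_eq_right (h1.trans (le_max_left _ _)), h2, mul_max_of_nonneg _ _ (by positivity),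
      mul_one]
  rw [h3]
  field_simp
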